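/- **Model.** Let $N^+$ be a positive integer-valued random variable with distribution function $F_1^+$ and probability mass function $f_{N^+}$, let $Y_1,Y_2,\dots$ be real random variables, and let $F_2$ be a distribution function on $[0,\infty)$ with probability density $f_2$. Fix a correlation structure $z\in\{1,2\}$ and $\rho_1,\rho_2\in(-1,1)$. For $k\ge1$ let $\Sigma_{\rho_2}^{[k,z]}$ be the $k\times k$ matrix with diagonal entries $1$ and, for $i\ne j$, entries $\rho_2$ if $z=1$ and $\rho_2^{|i-j|}$ if $z=2$, and let $$\Sigma_{\rho_1,\rho_2}^{[k,z]}=\begin{pmatrix}1&\rho_1\mathbf 1_k^{\mathrm T}\\ \rho_1\mathbf 1_k&\Sigma_{\rho_2}^{[k,z]}\end{pmatrix}.$$ If $z=1$ assume $\rho_1^2<\rho_2$; if $z=2$ assume that $\Sigma_{\rho_1,\rho_2}^{[k,z]}$ is positive definite for every $k\ge 1$ with $P(N^+\ge k)>0$. Assume that, for every $k\ge1$ with $P(N^+\ge k)>0$, the joint distribution function of $(N^+,Y_1,\dots,Y_k)$ is $C(F_1^+,F_2,\dots,F_2)$, where $C$ is either (a) the Gaussian copula with correlation matrix $\Sigma_{\rho_1,\rho_2}^{[k,z]}$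 or (b) the $t$ copula with scale matrix $\Sigma_{\rho_1,\rho_2}^{[k,z]}$ and $\mathrm{df}>0$ degrees of freedom (the same alternative, and the same $\mathrm{df}$, for all $k$). Let $R$ be a Bernoulli variable with success probability $p\in[0,1]$, independent of $(N^+,Y_1,\dots,Y_k)$ for every $k$. Put $N=N^+$ if $R=1$, $N=0$ if $R=0$, $S=\sum_{j=1}^N Y_j$, and $M=S/N$ on $\{N>0\}$. For a positive integer $n$ let $h=h_{N^+,Y^{[1]}}$ be, in case (a), with $\Phi$ the standard normal distribution function, $$h(n,y)=f_2(y)\left(\Phi\Big(\tfrac{\Phi^{-1}(F_1^+(n))-\mu}{\sigma}\Big)-\Phi\Big(\tfrac{\Phi^{-1}(F_1^+(n-1))-\mu}{\sigma}\Big)\right),\quad \mu=\rho_1\Phi^{-1}(F_2(y)),\ \sigma=\sqrt{1-\rho_1^2},$$ and in case (b), with $\Phi_\nu$ the distribution function of the Student $t$ distribution with $\nu$ degrees of freedom, $$h(n,y)=f_2(y)\left(\Phi_{\mathrm{df}+1}\Big(\tfrac{\Phi_{\mathrm{df}}^{-1}(F_1^+(n))-\mu}{\sigma}\Big)-\Phi_{\mathrm{df}+1}\Big(\tfrac{\Phi_{\mathrm{df}}^{-1}(F_1^+(n-1))-\mu}{\sigma}\Big)\right),\quad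 \mu=\rho_1\Phi_{\mathrm{df}}^{-1}(F_2(y)),\ \sigma=\sqrt{1-\rho_1^2}\,\sqrt{\tfrac{\mathrm{df}+\Phi_{\mathrm{df}}^{-1}(F_2(y))^2}{\mathrm{df}+1}},$$ where in the numerators $\Phi^{-1}(0)=-\infty$ and $\Phi^{-1}(1)=+\infty$ (likewise for $\Phi_{\mathrm{df}}^{-1}$). Those $y$ with $F_2(y)\in\{0,1\}$ form a null set for the severity law, and there the quantile of $F_2(y)$ may be given any real value. **Claim.** 1. $S\ge0$ almost surely, $h\ge0$, and $$E[S]=p\sum_{n=1}^\infty n\int_0^\infty y\,h(n,y)\,dy ,$$ as an identity in $[0,\infty]$, and as an identity between real numbers if $S$ is integrable. 2. If $N$, $S$ and $NS$ are integrable, then $$\mathrm{Cov}(N,S)=p\sum_{n=1}^\infty n^2\int_0^\infty y\,h(n,y)\,dy-\left(p\sum_{n=1}^\infty n f_{N^+}(n)\right)\left(p\sum_{n=1}^\infty n\int_0^\infty y\,h(n,y)\,dy\right).$$ 3. If $p>0$ and $N$, $S$ are integrable, then $$\mathrm{Cov}(N,M\mid N>0)=\sum_{n=1}^\infty n\int_0^\infty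 y\,h(n,y)\,dy-\left(\sum_{n=1}^\infty n f_{N^+}(n)\right)\left(\sum_{n=1}^\infty \int_0^\infty y\,h(n,y)\,dy\right).$$ If $p>0$, all integrals and series in the real-valued identities of 1, 2 and 3 converge under the stated integrability assumptions. -/

import Mathlib

open MeasureTheory ProbabilityTheory Set
open scoped ENNReal Matrix

noncomputable section

namespace CollectiveRisk

/-! ### Correlation matrices -/

/-- The two correlation structures of the severities: equicorrelation (`z = 1`) and
autoregressive correlation (`z = 2`). -/
inductive CorrType
  | equi
  | autoreg

/-- The `k × k` correlation matrix `Σ_{ρ₂}^{[k,z]}` of the severities. -/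
def sevCorr (z : CorrType) (ρ₂ : ℝ) (k : ℕ) : Matrix (Fin k) (Fin k) ℝ :=
  Matrix.of fun i j =>
    match z with
    | .equi => if i = j then 1 else ρ₂
    | .autoreg => if i = j then 1 else ρ₂ ^ ((i : ℤ) - (j : ℤ)).natAbs

/-- The `(k+1) × (k+1)` correlation matrix `Σ_{ρ₁,ρ₂}^{[k,z]}`; index `0` is the frequency and
the indices `1, …, k` are the severities. -/
def fullCorr (z : CorrType) (ρ₁ ρ₂ : ℝ) (k : ℕ) : Matrix (Fin (k + 1)) (Fin (k + 1)) ℝ :=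
  Matrix.of (Fin.cons (Fin.cons 1 fun _ => ρ₁) fun i => Fin.cons ρ₁ fun j => sevCorr z ρ₂ k i j)

/-! ### Normal and Student distributions and their copulas -/

/-- The density of the centred multivariate normal distribution with covariance matrix `A`. -/
def mvNormalPDF {k : ℕ} (A : Matrix (Fin k) (Fin k) ℝ) (x : Fin k → ℝ) : ℝ :=
  ((2 * Real.pi) ^ ((k : ℝ) / 2) * Real.sqrt A.det)⁻¹ * Real.exp (-(x ⬝ᵥ (A⁻¹ *ᵥ x)) / 2)

/-- The density of the centred multivariate `t` distribution with scale matrix `A` and `df`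
degrees of freedom. -/
def mvStudentPDF (df : ℝ) {k : ℕ} (A : Matrix (Fin k) (Fin k) ℝ) (x : Fin k → ℝ) : ℝ :=
  Real.Gamma ((k + df) / 2) /
      (Real.Gamma (df / 2) * (Real.pi * df) ^ ((k : ℝ) / 2) * Real.sqrt A.det) *
    (1 + (x ⬝ᵥ (A⁻¹ *ᵥ x)) / df) ^ (-((k + df) / 2))

/-- The density of the univariate Student `t` distribution with `df` degrees of freedom. -/
def studentPDF (df : ℝ) (x : ℝ) : ℝ :=
  Real.Gamma ((df + 1) / 2) / (Real.Gamma (df / 2) * Real.sqrt (Real.pi * df)) *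
    (1 + x ^ 2 / df) ^ (-((df + 1) / 2))

/-- The univariate Student `t` distribution with `df` degrees of freedom. -/
def studentMeasure (df : ℝ) : Measure ℝ :=
  volume.withDensity fun x => ENNReal.ofReal (studentPDF df x)

/-- The copula families: Gaussian, or Student `t` with `df > 0` degrees of freedom. -/
inductive Family
  | gaussian
  | student (df : ℝ) (hdf : 0 < df)

namespace Family

/-- The univariate law (standard normal or Student `t`) whose distribution function is
`Φ` or `Φ_df`. -/
def margLaw : Family → Measure ℝ
  | gaussian => gaussianReal 0 1
  | student df _ => studentMeasure df

/-- The density of `margLaw`. -/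
def margPDF : Family → ℝ → ℝ
  | gaussian, x => gaussianPDFReal 0 1 x
  | student df _, x => studentPDF df x

/-- The law whose distribution function is `Φ` or `Φ_{df + k}`. -/
def condLaw (c : Family) (k : ℕ) : Measure ℝ :=
  match c with
  | gaussian => gaussianReal 0 1
  | student df _ => studentMeasure (df + k)

/-- The multivariate density (normal or `t`) with correlation/scale matrix `A`. -/
def mvPDF (c : Family) {k : ℕ} (A : Matrix (Fin k) (Fin k) ℝ) (x : Fin k → ℝ) : ℝ :=
  match c with
  | gaussian => mvNormalPDF A x
  | student df _ => mvStudentPDF df A x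

/-- The multivariate law (normal or `t`) with correlation/scale matrix `A`. -/
def mvLaw (c : Family) {k : ℕ} (A : Matrix (Fin k) (Fin k) ℝ) :
    Measure (EuclideanSpace ℝ (Fin k)) :=
  match c with
  | gaussian => multivariateGaussian 0 A
  | student df _ => volume.withDensity fun x => ENNReal.ofReal (mvStudentPDF df A fun i => x i)

/-- The copula `C_A` (or `C_{df,A}`): the joint distribution function of
`(Φ(Z₁), …, Φ(Z_k))`, where `Z` has law `mvLaw` and `Φ` is the common distribution function of
the margins. -/
def copula (c : Family) {k : ℕ} (A : Matrix (Fin k) (Fin k) ℝ) (u : Fin k → ℝ) : ℝ :=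
  (c.mvLaw A).real {x | ∀ i, cdf c.margLaw (x i) ≤ u i}

end Family

/-- The distribution function of `ν` on the extended real line (value `0` at `-∞` and the total
mass at `+∞`). -/
def extCDF (ν : Measure ℝ) (x : EReal) : ℝ := ν.real {t : ℝ | (t : EReal) ≤ x}

/-- The quantile function of `ν`, with values in the extended real line, so that
`Φ⁻¹(0) = -∞` and `Φ⁻¹(1) = +∞`. -/
def quantile (ν : Measure ℝ) (u : ℝ) : EReal := sInf {x : EReal | u ≤ extCDF ν x}

namespace Family

/-- The copula density `c_A(u) = f_A(q₁, …, q_k) / ∏ f(q_i)` with `q_i = Φ⁻¹(u_i)`. -/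
def copulaPDF (c : Family) {k : ℕ} (A : Matrix (Fin k) (Fin k) ℝ) (u : Fin k → ℝ) : ℝ :=
  c.mvPDF A (fun i => (quantile c.margLaw (u i)).toReal) /
    ∏ i, c.margPDF (quantile c.margLaw (u i)).toReal

end Family

/-! ### The model -/

/-- The parameters of the dependent collective risk model. -/
structure Params where
  /-- the copula family -/
  fam : Family
  /-- the correlation structure -/
  z : CorrType
  /-- correlation parameter between the frequency and each severity -/
  ρ₁ : ℝ
  /-- correlation parameter between severities -/
  ρ₂ : ℝ
  /-- the density of an individual severity -/
  f₂ : ℝ → ℝ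
  /-- the probability of a positive frequency -/
  p : ℝ

namespace Params

variable (θ : Params)

/-- The law of an individual severity. -/
def sevLaw : Measure ℝ := volume.withDensity fun y => ENNReal.ofReal (θ.f₂ y)

/-- The distribution function `F₂` of an individual severity. -/
def F₂ (y : ℝ) : ℝ := cdf θ.sevLaw y

/-- The vector `(Φ⁻¹(F₂(y₁)), …, Φ⁻¹(F₂(y_k)))`. -/
def scores {k : ℕ} (y : Fin k → ℝ) : Fin k → ℝ :=
  fun i => (quantile θ.fam.margLaw (θ.F₂ (y i))).toReal

/-- The density `f_{Y^{[k]}}` of `(Y₁, …, Y_k)`. -/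
def sevPDF {k : ℕ} (y : Fin k → ℝ) : ℝ :=
  θ.fam.copulaPDF (sevCorr θ.z θ.ρ₂ k) (fun i => θ.F₂ (y i)) * ∏ i, θ.f₂ (y i)

/-- The conditional location `μ_{[k,z]}`. -/
def condLoc {k : ℕ} (y : Fin k → ℝ) : ℝ :=
  (fun _ => θ.ρ₁) ⬝ᵥ ((sevCorr θ.z θ.ρ₂ k)⁻¹ *ᵥ θ.scores y)

/-- The conditional scale `σ_{[k,z]}` (Gaussian family) or `σ*_{[k,z]}` (`t` family). -/
def condScale {k : ℕ} (y : Fin k → ℝ) : ℝ :=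
  Real.sqrt (1 - (fun _ => θ.ρ₁) ⬝ᵥ ((sevCorr θ.z θ.ρ₂ k)⁻¹ *ᵥ fun _ => θ.ρ₁)) *
    match θ.fam with
    | .gaussian => 1
    | .student df _ =>
      Real.sqrt ((df + θ.scores y ⬝ᵥ ((sevCorr θ.z θ.ρ₂ k)⁻¹ *ᵥ θ.scores y)) / (df + k))

/-- `Φ((Φ⁻¹(u) - μ_{[k,z]}) / σ_{[k,z]})`, respectively
`Φ_{df+k}((Φ_df⁻¹(u) - μ*_{[k,z]}) / σ*_{[k,z]})`. -/
def condCDFAt {k : ℕ} (u : ℝ) (y : Fin k → ℝ) : ℝ :=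
  extCDF (θ.fam.condLaw k)
    ((quantile θ.fam.margLaw u - (θ.condLoc y : EReal)) / (θ.condScale y : EReal))

/-- The joint density `h_{N⁺,Y^{[k]}}(n, y)`, where `F₁` is the distribution function of `N⁺`. -/
def jointPDF (F₁ : ℝ → ℝ) {k : ℕ} (n : ℤ) (y : Fin k → ℝ) : ℝ :=
  θ.sevPDF y * (θ.condCDFAt (F₁ n) y - θ.condCDFAt (F₁ ((n : ℝ) - 1)) y)

end Params

section Variables

variable {Ω : Type*}

/-- The frequency `N`: equal to `N⁺` if `R = 1` and to `0` if `R = 0`. -/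
def freq (Nplus : Ω → ℕ) (R : Ω → Bool) (ω : Ω) : ℕ := if R ω = true then Nplus ω else 0

/-- The aggregate severity `S`, the sum of the first `N` severities (`Y 0` is the first one). -/
def aggregate (Nplus : Ω → ℕ) (R : Ω → Bool) (Y : ℕ → Ω → ℝ) (ω : Ω) : ℝ :=
  ∑ j ∈ Finset.range (freq Nplus R ω), Y j ω

/-- The average severity `M = S / N`; it is only used on the event `N > 0`. -/
def average (Nplus : Ω → ℕ) (R : Ω → Bool) (Y : ℕ → Ω → ℝ) (ω : Ω) : ℝ :=
  aggregate Nplus R Y ω / freq Nplus R ω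

variable [MeasurableSpace Ω]

/-- The distribution function `F₁⁺` of `N⁺`. -/
def freqCDF (P : Measure Ω) (Nplus : Ω → ℕ) (x : ℝ) : ℝ :=
  cdf (P.map fun ω => (Nplus ω : ℝ)) x

/-- The bivariate density `h_{N⁺,Y^{[1]}}(n, y)`. -/
def hPDF (θ : Params) (P : Measure Ω) (Nplus : Ω → ℕ) (n : ℤ) (y : ℝ) : ℝ :=
  θ.jointPDF (freqCDF P Nplus) n ![y]

/-- The dependent collective risk model with parameters `θ`. Here `Y j` is the `(j+1)`-st severity.
The copula of `(N⁺, Y₁, …, Y_k)` is prescribed for every `k ≥ 1` that `N⁺` can reach or exceed. -/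
structure IsModel (θ : Params) (P : Measure Ω) (Nplus : Ω → ℕ) (Y : ℕ → Ω → ℝ)
    (R : Ω → Bool) : Prop where
  measurable_Nplus : Measurable Nplus
  measurable_Y : ∀ j, Measurable (Y j)
  measurable_R : Measurable R
  Nplus_pos : ∀ᵐ ω ∂P, 0 < Nplus ω
  measurable_f₂ : Measurable θ.f₂
  f₂_nonneg : ∀ y, 0 ≤ θ.f₂ y
  sevLaw_univ : θ.sevLaw univ = 1
  sevLaw_neg : θ.sevLaw (Iio 0) = 0
  ρ₁_mem : θ.ρ₁ ∈ Ioo (-1 : ℝ) 1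
  ρ₂_mem : θ.ρ₂ ∈ Ioo (-1 : ℝ) 1
  equi_cond : θ.z = CorrType.equi → θ.ρ₁ ^ 2 < θ.ρ₂
  autoreg_posDef : θ.z = CorrType.autoreg → ∀ k : ℕ, 0 < k → 0 < P {ω | k ≤ Nplus ω} →
    (fullCorr θ.z θ.ρ₁ θ.ρ₂ k).PosDef
  joint : ∀ k : ℕ, 0 < k → 0 < P {ω | k ≤ Nplus ω} → ∀ (n : ℕ) (y : Fin k → ℝ),
    P.real {ω | Nplus ω ≤ n ∧ ∀ i : Fin k, Y i ω ≤ y i} =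
      θ.fam.copula (fullCorr θ.z θ.ρ₁ θ.ρ₂ k)
        (Fin.cons (freqCDF P Nplus n) fun i => θ.F₂ (y i))
  prob_R : P {ω | R ω = true} = ENNReal.ofReal θ.p
  p_mem : θ.p ∈ Icc (0 : ℝ) 1
  indep : ∀ k : ℕ, IndepFun R (fun ω => (Nplus ω, fun i : Fin k => Y i ω)) P

end Variables

end CollectiveRisk

end

namespace CollectiveRisk

/-! ### The Student distribution -/

/-! Everything rests on one fact: for `j < n`, the law of `Y j` restricted to the event `N⁺ = n` has
density `h(n, ·)`, whatever `j` is (`IsModel.map_restrict_eq`).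

To see this, let all severity arguments but one tend to infinity in the copula identity. What
remains is the law of two coordinates `(Z₀, Z)` of a normal or `t` vector with correlation `ρ₁`
(`IsModel.real_le_le`). Given `Z = x`, the coordinate `Z₀` is distributed as `ρ₁ x + √(1 - ρ₁²) s(x)
W`, where `s = 1` and `W` is normal in the Gaussian case, and `s(x)² = (df + x²)/(df + 1)` and `W`
is Student with `df + 1` degrees of freedom in the other (`Family.map_mvLaw_pair`). The substitution
`x = Φ⁻¹(F₂(t))` (`setLIntegral_cdf_le`) turns this into a density in `t` for `Y j` on `N⁺ ≤ n`, and
the difference of the levels `n` and `n - 1` is `h`. If `N⁺ = n` has probability zero, the copula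
may say nothing about `Y j`, but then `h(n, ·) = 0`.

Summing over `j < n` and over `n`, and using the independence of `R`, one gets `E[w(N) S] = p ∑ w(n)
n ∫ y h(n, y) dy` in `[0, ∞]` for every weight `w ≥ 0` (`IsModel.lintegral_mul_aggregate`). The
weights `1`, `n` and `1/n` give the means of `S`, `N S` and `M`. The covariances follow from `E[XZ]
- E[X] E[Z]`; conditioning on `N > 0` divides each mean by `p`. -/

lemma studentPDF_pos {df : ℝ} (hdf : 0 < df) (x : ℝ) : 0 < studentPDF df x := by
  unfold studentPDF
  have h1 := Real.Gamma_pos_of_pos (show 0 < (df + 1) / 2 by positivity)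
  have h2 := Real.Gamma_pos_of_pos (show 0 < df / 2 by positivity)
  positivity

@[fun_prop]
lemma measurable_studentPDF (df : ℝ) : Measurable (studentPDF df) := by
  unfold studentPDF
  fun_prop

/-- The Student density is a gamma mixture of centred normal densities. -/
lemma studentPDF_mul_gamma {df : ℝ} (hdf : 0 < df) (x : ℝ) {w : ℝ} (hw : 0 < w) :
    studentPDF df x * gammaPDFReal (df / 2 + 1 / 2) (df / 2 + x ^ 2 / 2) w =
      gaussianPDFReal 0 (Real.toNNReal w⁻¹) x * gammaPDFReal (df / 2) (df / 2) w := by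
  have h1 := Real.Gamma_pos_of_pos (show 0 < (df + 1) / 2 by positivity)
  have h2 := Real.Gamma_pos_of_pos (show 0 < df / 2 by positivity)
  have hq : 0 < 1 + x ^ 2 / df := by positivity
  have e1 : df / 2 + x ^ 2 / 2 = (df / 2) * (1 + x ^ 2 / df) := by field_simp
  have e2 : df / 2 + 1 / 2 = (df + 1) / 2 := by ring
  unfold studentPDF gammaPDFReal gaussianPDFReal
  rw [if_pos hw.le, if_pos hw.le, Real.coe_toNNReal _ (inv_nonneg.2 hw.le), e1, e2,
    Real.mul_rpow (by positivity) hq.le, Real.rpow_neg hq.le]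
  have e3 : (df / 2) ^ ((df + 1) / 2) = (df / 2) ^ (df / 2) * Real.sqrt (df / 2) := by
    rw [Real.sqrt_eq_rpow, ← Real.rpow_add (by positivity)]
    congr 1
    ring
  have e4 : w ^ ((df + 1) / 2 - 1) = w ^ (df / 2 - 1) * Real.sqrt w := by
    rw [Real.sqrt_eq_rpow, ← Real.rpow_add (by positivity)]
    congr 1
    ring
  have e5 : Real.exp (-(df / 2 * (1 + x ^ 2 / df) * w)) =
      Real.exp (-(x - 0) ^ 2 / (2 * w⁻¹)) * Real.exp (-(df / 2 * w)) := by
    rw [← Real.exp_add]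
    congr 1
    field_simp
    ring
  rw [e3, e4, e5, Real.sqrt_mul (by positivity : (0 : ℝ) ≤ 2 * Real.pi), Real.sqrt_inv,
    Real.sqrt_mul (by positivity : (0 : ℝ) ≤ 2), Real.sqrt_mul Real.pi_pos.le,
    Real.sqrt_div hdf.le]
  have h3 : 0 < (1 + x ^ 2 / df) ^ ((df + 1) / 2) := by positivity
  have h4 : 0 < Real.sqrt w := Real.sqrt_pos.2 hw
  have h5 : 0 < Real.sqrt df := Real.sqrt_pos.2 hdf
  have h6 : 0 < Real.sqrt Real.pi := Real.sqrt_pos.2 Real.pi_pos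
  field_simp

/-- Integrating the gamma mixture in either order (Tonelli) reduces the total mass to those of the
normal and gamma densities. -/
lemma lintegral_studentPDF {df : ℝ} (hdf : 0 < df) :
    ∫⁻ x, ENNReal.ofReal (studentPDF df x) = 1 := by
  have hG (x : ℝ) : ∫⁻ w in Ioi 0, gammaPDF (df / 2 + 1 / 2) (df / 2 + x ^ 2 / 2) w = 1 := by
    rw [← lintegral_gammaPDF_eq_one (a := df / 2 + 1 / 2) (r := df / 2 + x ^ 2 / 2)
      (by positivity) (by positivity), setLIntegral_congr Ioi_ae_eq_Ici]
    refine setLIntegral_eq_of_support_subset ?_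
    intro w hw
    by_contra h
    exact hw (gammaPDF_of_neg (not_le.1 h))
  have hG' : ∫⁻ w in Ioi 0, gammaPDF (df / 2) (df / 2) w = 1 := by
    rw [← lintegral_gammaPDF_eq_one (a := df / 2) (r := df / 2)
      (by positivity) (by positivity), setLIntegral_congr Ioi_ae_eq_Ici]
    refine setLIntegral_eq_of_support_subset ?_
    intro w hw
    by_contra h
    exact hw (gammaPDF_of_neg (not_le.1 h))
  have hm : Measurable fun q : ℝ × ℝ =>
      gaussianPDFReal 0 (Real.toNNReal q.2⁻¹) q.1 * gammaPDFReal (df / 2) (df / 2) q.2 := by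
    have := measurable_gammaPDFReal (df / 2) (df / 2)
    unfold gaussianPDFReal
    fun_prop
  calc ∫⁻ x, ENNReal.ofReal (studentPDF df x)
      = ∫⁻ x, ∫⁻ w in Ioi 0, ENNReal.ofReal (gaussianPDFReal 0 (Real.toNNReal w⁻¹) x *
          gammaPDFReal (df / 2) (df / 2) w) := by
        refine lintegral_congr fun x => ?_
        rw [← mul_one (ENNReal.ofReal _), ← hG x, ← lintegral_const_mul']
        · refine setLIntegral_congr_fun measurableSet_Ioi fun w hw => ?_
          rw [← studentPDF_mul_gamma hdf x hw, ENNReal.ofReal_mul (studentPDF_pos hdf x).le]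
          rfl
        · exact ENNReal.ofReal_ne_top
    _ = ∫⁻ w in Ioi 0, ∫⁻ x, ENNReal.ofReal (gaussianPDFReal 0 (Real.toNNReal w⁻¹) x *
          gammaPDFReal (df / 2) (df / 2) w) := by
        refine lintegral_lintegral_swap ?_
        exact hm.ennreal_ofReal.aemeasurable
    _ = ∫⁻ w in Ioi 0, gammaPDF (df / 2) (df / 2) w := by
        refine setLIntegral_congr_fun measurableSet_Ioi fun w hw => ?_
        simp only [ENNReal.ofReal_mul (gaussianPDFReal_nonneg _ _ _)]
        rw [lintegral_mul_const' _ _ ENNReal.ofReal_ne_top, lintegral_gaussianPDFReal_eq_one,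
          one_mul]
        · rfl
        · simpa using hw
    _ = 1 := hG'

lemma isProbabilityMeasure_studentMeasure {df : ℝ} (hdf : 0 < df) :
    IsProbabilityMeasure (studentMeasure df) :=
  ⟨by rw [studentMeasure, withDensity_apply _ MeasurableSet.univ, Measure.restrict_univ,
    lintegral_studentPDF hdf]⟩

/-! ### Disintegration of the spherical multivariate Student density -/

lemma mvStudentPDF_one (df : ℝ) {m : ℕ} (z : Fin m → ℝ) :
    mvStudentPDF df 1 z =
      Real.Gamma ((m + df) / 2) / (Real.Gamma (df / 2) * (Real.pi * df) ^ ((m : ℝ) / 2)) *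
        (1 + (z ⬝ᵥ z) / df) ^ (-((m + df) / 2)) := by
  simp [mvStudentPDF]

@[fun_prop]
lemma measurable_mvStudentPDF (df : ℝ) {m : ℕ} (A : Matrix (Fin m) (Fin m) ℝ) :
    Measurable (mvStudentPDF df A) := by
  unfold mvStudentPDF
  have : Measurable fun x : Fin m → ℝ => x ⬝ᵥ (A⁻¹ *ᵥ x) := by
    unfold Matrix.mulVec dotProduct
    fun_prop
  fun_prop

/-- The scale of the next coordinate given the first `m` coordinates `z`. -/
noncomputable def sphScale (df : ℝ) {m : ℕ} (z : Fin m → ℝ) : ℝ := Real.sqrt ((df + z ⬝ᵥ z) / (df + m))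

lemma dotProduct_self_nonneg_real {m : ℕ} (z : Fin m → ℝ) : 0 ≤ z ⬝ᵥ z :=
  Finset.sum_nonneg fun i _ => mul_self_nonneg (z i)

lemma sphScale_pos {df : ℝ} (hdf : 0 < df) {m : ℕ} (z : Fin m → ℝ) : 0 < sphScale df z := by
  have := dotProduct_self_nonneg_real z
  unfold sphScale
  positivity

/-- With `s² = (df + |z|²)/(df + m)`, the quantity `1 + (|z|² + s² w²)/df` factors as `(1 +
|z|²/df)(1 + w²/(df + m))`. The factor `s` is the Jacobian of the rescaling. -/
lemma mvStudentPDF_one_snoc {df : ℝ} (hdf : 0 < df) {m : ℕ} (z : Fin m → ℝ) (w : ℝ) :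
    sphScale df z * mvStudentPDF df 1 (Fin.snoc z (sphScale df z * w) : Fin (m + 1) → ℝ) =
      mvStudentPDF df 1 z * studentPDF (df + m) w := by
  have hz := dotProduct_self_nonneg_real z
  have hs : sphScale df z ^ 2 = (df + z ⬝ᵥ z) / (df + m) := by
    unfold sphScale
    exact Real.sq_sqrt (by positivity)
  have hsnoc : (Fin.snoc z (sphScale df z * w) : Fin (m + 1) → ℝ) ⬝ᵥ
      (Fin.snoc z (sphScale df z * w) : Fin (m + 1) → ℝ) =
      z ⬝ᵥ z + sphScale df z ^ 2 * w ^ 2 := by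
    simp only [dotProduct, Fin.sum_univ_castSucc, Fin.snoc_castSucc, Fin.snoc_last]
    ring
  rw [mvStudentPDF_one, mvStudentPDF_one, hsnoc, hs, studentPDF]
  have h0 : 0 < 1 + z ⬝ᵥ z / df := by positivity
  have h0' : 0 < 1 + w ^ 2 / (df + m) := by positivity
  have e1 : 1 + (z ⬝ᵥ z + (df + z ⬝ᵥ z) / (df + m) * w ^ 2) / df =
      (1 + z ⬝ᵥ z / df) * (1 + w ^ 2 / (df + m)) := by
    field_simp
    ring
  have e2 : ((m + 1 : ℕ) + df) / 2 = (df + m + 1) / 2 := by push_cast; ring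
  have e3 : ((m + 1 : ℕ) : ℝ) / 2 = (m : ℝ) / 2 + 1 / 2 := by push_cast; ring
  have e4 : (1 + z ⬝ᵥ z / df) ^ (-((df + m + 1) / 2)) =
      (1 + z ⬝ᵥ z / df) ^ (-((m + df) / 2)) / Real.sqrt (1 + z ⬝ᵥ z / df) := by
    rw [Real.sqrt_eq_rpow, ← Real.rpow_sub h0]
    congr 1
    ring
  have e5 : sphScale df z =
      Real.sqrt (1 + z ⬝ᵥ z / df) * Real.sqrt df / Real.sqrt (df + m) := by
    rw [sphScale, Real.sqrt_div (by positivity), ← Real.sqrt_mul h0.le]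
    congr 2
    field_simp
  rw [e1, e2, e3, Real.mul_rpow h0.le h0'.le, e4, e5,
    Real.rpow_add (by positivity), ← Real.sqrt_eq_rpow, Real.sqrt_mul Real.pi_pos.le,
    Real.sqrt_mul Real.pi_pos.le, show (m + df) / 2 = (df + m) / 2 by ring]
  have h1 := Real.Gamma_pos_of_pos (show 0 < (df + m) / 2 by positivity)
  have h2 := Real.Gamma_pos_of_pos (show 0 < df / 2 by positivity)
  have h3 : 0 < Real.sqrt df := Real.sqrt_pos.2 hdf
  have h4 : 0 < Real.sqrt Real.pi := Real.sqrt_pos.2 Real.pi_pos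
  have h5 : 0 < Real.sqrt (df + m) := Real.sqrt_pos.2 (by positivity)
  have h6 : 0 < Real.sqrt (1 + z ⬝ᵥ z / df) := Real.sqrt_pos.2 h0
  have h7 : 0 < (Real.pi * df) ^ ((m : ℝ) / 2) := by positivity
  field_simp

lemma lintegral_mul_left_real (g : ℝ → ℝ≥0∞) {s : ℝ} (hs : 0 < s) :
    ∫⁻ x, g x = ENNReal.ofReal s * ∫⁻ w, g (s * w) := by
  have h := Real.map_volume_mul_left (a := s) hs.ne'
  have h2 : ∫⁻ w, g (s * w) = ∫⁻ x, g x ∂(Measure.map (fun w => s * w) volume) :=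
    ((Homeomorph.mulLeft₀ s hs.ne').toMeasurableEquiv.measurableEmbedding.lintegral_map g).symm
  rw [h2, h, lintegral_smul_measure, smul_eq_mul, ← mul_assoc,
    ← ENNReal.ofReal_mul hs.le, abs_of_pos (inv_pos.2 hs), mul_inv_cancel₀ hs.ne',
    ENNReal.ofReal_one, one_mul]

lemma lintegral_mvStudentPDF_one_succ {df : ℝ} (hdf : 0 < df) {m : ℕ}
    {F : (Fin (m + 1) → ℝ) → ℝ≥0∞} (hF : Measurable F) :
    ∫⁻ x, F x * ENNReal.ofReal (mvStudentPDF df 1 x) =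
      ∫⁻ z : Fin m → ℝ, ENNReal.ofReal (mvStudentPDF df 1 z) *
        ∫⁻ w, F (Fin.snoc z (sphScale df z * w)) ∂studentMeasure (df + m) := by
  have e := volume_preserving_piFinSuccAbove (fun _ : Fin (m + 1) => ℝ) (Fin.last m)
  have hsnoc : Measurable fun q : ℝ × (Fin m → ℝ) => (Fin.snoc q.2 q.1 : Fin (m + 1) → ℝ) := by
    refine measurable_pi_lambda _ fun i => ?_
    refine Fin.lastCases ?_ (fun i => ?_) i
    · simpa using measurable_fst
    · simp only [Fin.snoc_castSucc]
      fun_prop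
  have he (q : ℝ × (Fin m → ℝ)) :
      (MeasurableEquiv.piFinSuccAbove (fun _ : Fin (m + 1) => ℝ) (Fin.last m)).symm q =
        (Fin.snoc q.2 q.1 : Fin (m + 1) → ℝ) := by
    simp [MeasurableEquiv.piFinSuccAbove, Fin.insertNthEquiv]
  rw [← e.symm.lintegral_comp_emb (MeasurableEquiv.measurableEmbedding _)]
  simp only [he]
  rw [Measure.volume_eq_prod, lintegral_prod_symm' _ (by fun_prop)]
  refine lintegral_congr fun z => ?_
  have hs := sphScale_pos hdf z
  have hdm : 0 < df + m := by positivity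
  rw [lintegral_mul_left_real _ hs, studentMeasure,
    lintegral_withDensity_eq_lintegral_mul _ (by fun_prop) (by fun_prop),
    ← lintegral_const_mul' _ _ ENNReal.ofReal_ne_top,
    ← lintegral_const_mul' _ _ ENNReal.ofReal_ne_top]
  refine lintegral_congr fun w => ?_
  have hpos : 0 ≤ mvStudentPDF df 1 z := by
    rw [mvStudentPDF_one]
    have h1 := Real.Gamma_pos_of_pos (show 0 < (m + df) / 2 by positivity)
    have h2 := Real.Gamma_pos_of_pos (show 0 < df / 2 by positivity)
    have := dotProduct_self_nonneg_real z
    positivity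
  have key := congrArg ENNReal.ofReal (mvStudentPDF_one_snoc hdf z w)
  rw [ENNReal.ofReal_mul hs.le, ENNReal.ofReal_mul hpos] at key
  rw [mul_left_comm, key]
  simp only [Pi.mul_apply]
  ring

/-! ### Bivariate margins of the normal and Student laws -/

open scoped MatrixOrder RealInnerProductSpace in
/-- A positive definite matrix with two unit diagonal entries has a square factor adapted to the
corresponding two coordinates. -/
lemma exists_factor {n : ℕ} {A : Matrix (Fin (n + 2)) (Fin (n + 2)) ℝ} (hA : A.PosDef)
    {i j : Fin (n + 2)} (hi : A i i = 1) (hj : A j j = 1) (hr : A i j ^ 2 < 1) :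
    ∃ T : Matrix (Fin (n + 2)) (Fin (n + 2)) ℝ, T * Tᵀ = A ∧
      ∀ z, (T *ᵥ z) j = z 0 ∧ (T *ᵥ z) i = A i j * z 0 + Real.sqrt (1 - A i j ^ 2) * z 1 := by
  set r := A i j with hrdef
  set σ := Real.sqrt (1 - r ^ 2) with hσ
  have hσpos : 0 < σ := Real.sqrt_pos.2 (by linarith)
  have hσsq : σ ^ 2 = 1 - r ^ 2 := Real.sq_sqrt (by linarith)
  obtain ⟨B, hB⟩ : ∃ B : Matrix (Fin (n + 2)) (Fin (n + 2)) ℝ, A = Bᵀ * B := by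
    refine ⟨CFC.sqrt A, ?_⟩
    have h1 := CFC.sqrt_mul_sqrt_self A hA.posSemidef.nonneg
    have h2 : star (CFC.sqrt A) = CFC.sqrt A := (CFC.sqrt_nonneg A).isSelfAdjoint
    rw [Matrix.star_eq_conjTranspose, Matrix.conjTranspose_eq_transpose_of_trivial] at h2
    rw [h2, h1]
  -- The columns of `B` have Gram matrix `A`. Gram–Schmidt on `v j`, `v i` gives two orthonormal
  -- vectors; extend them to a basis `b` and let row `a` of `T` hold the coordinates of `v a` in
  -- `b`.
  let v : Fin (n + 2) → EuclideanSpace ℝ (Fin (n + 2)) := fun a => WithLp.toLp 2 fun l => B l a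
  have hv (a b) : ⟪v a, v b⟫ = A a b := by
    rw [hB, Matrix.mul_apply]
    simp [v, PiLp.inner_apply, mul_comm]
  have hsymm : A j i = r := by
    rw [← hv, real_inner_comm, hv]
  let b' : Fin (n + 2) → EuclideanSpace ℝ (Fin (n + 2)) :=
    fun a => if a = 0 then v j else σ⁻¹ • (v i - r • v j)
  have h01 : (1 : Fin (n + 2)) ≠ 0 := by simp
  have hnorm0 : ⟪v j, v j⟫ = 1 := by rw [hv, hj]
  have horth0 : ⟪v j, σ⁻¹ • (v i - r • v j)⟫ = 0 := by
    rw [inner_smul_right, inner_sub_right, inner_smul_right, hv, hv, hj, hsymm]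
    ring
  have hnorm1 : ⟪σ⁻¹ • (v i - r • v j), σ⁻¹ • (v i - r • v j)⟫ = 1 := by
    simp only [inner_smul_right, inner_sub_right, inner_smul_left, inner_sub_left, hv, hj, hsymm,
      hi, ← hrdef]
    simp only [RCLike.conj_to_real]
    field_simp
    linarith
  have hon : Orthonormal ℝ (({0, 1} : Set (Fin (n + 2))).domRestrict b') := by
    rw [orthonormal_iff_ite]
    rintro ⟨a, ha⟩ ⟨c, hc⟩
    simp only [mem_insert_iff, mem_singleton_iff] at ha hc
    rcases ha with rfl | rfl <;> rcases hc with rfl | rfl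
    · simpa [b'] using hnorm0
    · simpa [b'] using horth0
    · simp only [Set.domRestrict_apply, b', if_true, h01, if_false, Subtype.mk.injEq]
      rw [real_inner_comm]
      exact horth0
    · simpa only [Set.domRestrict_apply, b', h01, if_false, if_true] using hnorm1
  obtain ⟨b, hb⟩ := hon.exists_orthonormalBasis_extension_of_card_eq (by simp)
  have hb0 : b 0 = v j := by rw [hb 0 (by simp)]; simp [b']
  have hb1 : b 1 = σ⁻¹ • (v i - r • v j) := by rw [hb 1 (by simp)]; simp [b']
  have hvi : v i = r • b 0 + σ • b 1 := by
    rw [hb0, hb1, smul_smul, mul_inv_cancel₀ hσpos.ne']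
    simp
  refine ⟨Matrix.of fun a l => ⟪v a, b l⟫, ?_, fun z => ⟨?_, ?_⟩⟩
  -- Parseval's identity in the basis `b`.
  · ext a c
    rw [Matrix.mul_apply, ← hv, ← b.sum_inner_mul_inner]
    simp only [Matrix.of_apply, Matrix.transpose_apply, real_inner_comm]
  · simp only [Matrix.mulVec, dotProduct, Matrix.of_apply, ← hb0, b.inner_eq_ite]
    simp
  · simp only [Matrix.mulVec, dotProduct, Matrix.of_apply, hvi, inner_add_left, inner_smul_left,
      b.inner_eq_ite]
    simp [add_mul, Finset.sum_add_distrib]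

/-- Substitution `x = T z`: the quadratic form of `A⁻¹` becomes `|z|²`, and the Jacobian `|det T|`
equals `√(det A)`. -/
lemma lintegral_mvStudentPDF {n : ℕ} (df : ℝ) {A T : Matrix (Fin n) (Fin n) ℝ} (hA : A.PosDef)
    (hT : T * Tᵀ = A) {F : (Fin n → ℝ) → ℝ≥0∞} (hF : Measurable F) :
    ∫⁻ x, F x * ENNReal.ofReal (mvStudentPDF df A x) =
      ∫⁻ z, F (T *ᵥ z) * ENNReal.ofReal (mvStudentPDF df 1 z) := by
  have hdetA : A.det = T.det ^ 2 := by
    rw [← hT, Matrix.det_mul, Matrix.det_transpose, sq]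
  have hdet : T.det ≠ 0 := by
    intro h
    have := hA.det_pos
    rw [hdetA, h] at this
    simp at this
  have hunit : IsUnit T.det := isUnit_iff_ne_zero.2 hdet
  have habs : 0 < |T.det| := abs_pos.2 hdet
  have hquad (z : Fin n → ℝ) : (T *ᵥ z) ⬝ᵥ (A⁻¹ *ᵥ (T *ᵥ z)) = z ⬝ᵥ z := by
    have h1 : Tᵀ * (A⁻¹ * T) = 1 := by
      rw [← hT, Matrix.mul_inv_rev, Matrix.mul_assoc, Matrix.nonsing_inv_mul _ hunit,
        Matrix.mul_one, Matrix.mul_nonsing_inv]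
      rwa [Matrix.det_transpose]
    rw [Matrix.mulVec_mulVec, Matrix.dotProduct_mulVec, Matrix.vecMul_mulVec, h1,
      ← Matrix.dotProduct_mulVec, Matrix.one_mulVec]
  have hdens (z : Fin n → ℝ) :
      ENNReal.ofReal |T.det| * ENNReal.ofReal (mvStudentPDF df A (T *ᵥ z)) =
        ENNReal.ofReal (mvStudentPDF df 1 z) := by
    rw [← ENNReal.ofReal_mul habs.le, mvStudentPDF_one, mvStudentPDF, hquad, hdetA,
      Real.sqrt_sq_eq_abs]
    congr 1
    field_simp
  have hvol : (volume : Measure (Fin n → ℝ)) =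
      ENNReal.ofReal |T.det| • Measure.map (Matrix.toLin' T) volume := by
    rw [Real.map_matrix_volume_pi_eq_smul_volume_pi hdet, smul_smul, abs_inv,
      ← ENNReal.ofReal_mul habs.le, mul_inv_cancel₀ habs.ne', ENNReal.ofReal_one, one_smul]
  conv_lhs => rw [hvol]
  rw [lintegral_smul_measure, lintegral_map (by fun_prop)
    (Matrix.toLin' T).continuous_of_finiteDimensional.measurable, smul_eq_mul,
    ← lintegral_const_mul' _ _ ENNReal.ofReal_ne_top]
  refine lintegral_congr fun z => ?_
  rw [Matrix.toLin'_apply, mul_left_comm, hdens]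

/-- Coordinates beyond the first two are removed one at a time, from the last: the integrand ignores
them and their conditional law has mass one. -/
lemma lintegral_mvStudentPDF_one_fst_snd {df : ℝ} (hdf : 0 < df) (n : ℕ)
    {G : ℝ → ℝ → ℝ≥0∞} (hG : Measurable (Function.uncurry G)) :
    ∫⁻ z : Fin (n + 2) → ℝ, G (z 0) (z 1) * ENNReal.ofReal (mvStudentPDF df 1 z) =
      ∫⁻ x, ∫⁻ w, G x (Real.sqrt ((df + x ^ 2) / (df + 1)) * w) ∂studentMeasure (df + 1)
        ∂studentMeasure df := by
  have hGm (n : ℕ) : Measurable fun z : Fin (n + 2) → ℝ => G (z 0) (z 1) := by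
    have : Measurable fun z : Fin (n + 2) → ℝ => (z 0, z 1) := by fun_prop
    exact hG.comp this
  induction n with
  | zero =>
    have : IsProbabilityMeasure (studentMeasure (df + 1)) :=
      isProbabilityMeasure_studentMeasure (by positivity)
    have e := (volume_preserving_funUnique (Fin 1) ℝ).symm
    rw [lintegral_mvStudentPDF_one_succ hdf (m := 1) (hGm 0), show studentMeasure df =
      volume.withDensity fun x => ENNReal.ofReal (studentPDF df x) from rfl,
      lintegral_withDensity_eq_lintegral_mul _ (by fun_prop)]
    · refine (e.lintegral_comp_emb (MeasurableEquiv.measurableEmbedding _) _).symm.trans ?_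
      refine lintegral_congr fun x => ?_
      have h1 : mvStudentPDF df 1 ((MeasurableEquiv.funUnique (Fin 1) ℝ).symm x) =
          studentPDF df x := by
        have h0 : 0 < Real.pi * df := by positivity
        rw [mvStudentPDF_one, studentPDF, Real.sqrt_eq_rpow]
        simp [dotProduct, MeasurableEquiv.funUnique, uniqueElim, add_comm, sq]
      have h2 : sphScale df ((MeasurableEquiv.funUnique (Fin 1) ℝ).symm x) =
          Real.sqrt ((df + x ^ 2) / (df + 1)) := by
        simp [sphScale, dotProduct, MeasurableEquiv.funUnique, uniqueElim, sq]
      rw [h1, h2]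
      simp only [Pi.mul_apply, Nat.cast_one]
      rfl
    · have : Measurable fun q : ℝ × ℝ => (q.1, Real.sqrt ((df + q.1 ^ 2) / (df + 1)) * q.2) := by
        fun_prop
      exact Measurable.lintegral_prod_right' (hG.comp this)
  | succ n ih =>
    have hprob : IsProbabilityMeasure (studentMeasure (df + (n + 2 : ℕ))) :=
      isProbabilityMeasure_studentMeasure (by positivity)
    rw [lintegral_mvStudentPDF_one_succ hdf (m := n + 2) (hGm (n + 1)), ← ih]
    refine lintegral_congr fun z => ?_
    have h0 (s : ℝ) : (Fin.snoc z s : Fin (n + 2 + 1) → ℝ) 0 = z 0 :=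
      Fin.snoc_castSucc (α := fun _ => ℝ) s z 0
    have h1 (s : ℝ) : (Fin.snoc z s : Fin (n + 2 + 1) → ℝ) 1 = z 1 :=
      Fin.snoc_castSucc (α := fun _ => ℝ) s z 1
    simp only [h0, h1, lintegral_const, measure_univ, mul_one]
    rw [mul_comm]

namespace Family

/-- The factor of the conditional scale given one coordinate with value `x`. -/
noncomputable def scaleFactor : Family → ℝ → ℝ
  | gaussian, _ => 1
  | student df _, x => Real.sqrt ((df + x ^ 2) / (df + 1))

lemma scaleFactor_pos (c : Family) (x : ℝ) : 0 < c.scaleFactor x := by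
  cases c with
  | gaussian => exact one_pos
  | student df hdf => simp only [scaleFactor]; positivity

@[fun_prop]
lemma measurable_scaleFactor (c : Family) : Measurable c.scaleFactor := by
  cases c with
  | gaussian => exact measurable_const
  | student df hdf =>
    change Measurable fun x => Real.sqrt ((df + x ^ 2) / (df + 1))
    fun_prop

instance (c : Family) : IsProbabilityMeasure c.margLaw := by
  cases c with
  | gaussian => simp only [margLaw]; infer_instance
  | student df hdf => exact isProbabilityMeasure_studentMeasure hdf

instance (c : Family) (k : ℕ) : IsProbabilityMeasure (c.condLaw k) := by
  cases c with
  | gaussian => simp only [condLaw]; infer_instance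
  | student df hdf => exact isProbabilityMeasure_studentMeasure (by positivity)

/-- Two coordinates of `mvLaw`: given the second one, the first one has a rescaled conditional
law. -/
lemma map_mvLaw_pair (c : Family) {n : ℕ} {A : Matrix (Fin (n + 2)) (Fin (n + 2)) ℝ}
    (hA : A.PosDef) {i j : Fin (n + 2)} (hi : A i i = 1) (hj : A j j = 1) (hr : A i j ^ 2 < 1) :
    (c.mvLaw A).map (fun x => (x i, x j)) =
      (c.margLaw.prod (c.condLaw 1)).map fun q =>
        (A i j * q.1 + Real.sqrt (1 - A i j ^ 2) * c.scaleFactor q.1 * q.2, q.1) := by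
  have hσpos : 0 < Real.sqrt (1 - A i j ^ 2) := Real.sqrt_pos.2 (by linarith)
  have hσsq : Real.sqrt (1 - A i j ^ 2) ^ 2 = 1 - A i j ^ 2 := Real.sq_sqrt (by linarith)
  cases c with
  | gaussian =>
    set r := A i j with hrdef
    set σ := Real.sqrt (1 - r ^ 2) with hσ
    simp only [mvLaw, margLaw, condLaw, scaleFactor, mul_one]
    set μ := multivariateGaussian 0 A with hμ
    have hcov (a b : Fin (n + 2)) : cov[fun x => x a, fun x => x b; μ] = A a b :=
      covariance_eval_multivariateGaussian hA.posSemidef a b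
    let L : EuclideanSpace ℝ (Fin (n + 2)) →L[ℝ] ℝ × ℝ :=
      (EuclideanSpace.proj j).prod
        (σ⁻¹ • (EuclideanSpace.proj i - r • EuclideanSpace.proj j))
    have hLaw : HasGaussianLaw (fun x => ((x j : ℝ), σ⁻¹ * (x i - r * x j))) μ :=
      (IsGaussian.hasGaussianLaw_id (μ := μ)).map_fun L
    have hmem (a : Fin (n + 2)) : MemLp (fun x : EuclideanSpace ℝ (Fin (n + 2)) => x a) 2 μ :=
      HasGaussianLaw.memLp_two
        ((IsGaussian.hasGaussianLaw_id (μ := μ)).map_fun (EuclideanSpace.proj a))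
    have hjr : A j i = r := by
      have := hA.isHermitian.apply j i
      simpa using this.symm
    -- The normalised residual of `x i` after regression on `x j` is uncorrelated with `x j`, hence
    -- independent of it by joint normality.
    have hc : cov[fun x => x j, fun x => σ⁻¹ * (x i - r * x j); μ] = 0 := by
      rw [covariance_const_mul_right]
      have : cov[fun x => x j, fun x => x i - r * x j; μ] = 0 := by
        rw [covariance_fun_sub_right (hmem j) (hmem i) ((hmem j).const_mul r),
          covariance_const_mul_right, hcov, hcov, hj, hjr]
        ring
      rw [this, mul_zero]
    have hind := hLaw.indepFun_of_covariance_eq_zero hc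
    have hmap := (indepFun_iff_map_prod_eq_prod_map_map (by fun_prop) (by fun_prop)).1 hind
    have hXlaw : μ.map (fun x => (x j : ℝ)) = gaussianReal 0 1 := by
      have := (measurePreserving_eval_multivariateGaussian (μ := 0) hA.posSemidef (i := j)).map_eq
      simpa [hj] using this
    have hWlaw : μ.map (fun x => σ⁻¹ * (x i - r * x j)) = gaussianReal 0 1 := by
      rw [hLaw.snd.map_eq_gaussianReal]
      have hint (a : Fin (n + 2)) : ∫ x, x a ∂μ = 0 := by
        have h1 : μ.map (fun x => (x a : ℝ)) = gaussianReal 0 (A a a).toNNReal :=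
          (measurePreserving_eval_multivariateGaussian (μ := 0) hA.posSemidef (i := a)).map_eq
        have h2 : ∫ x, x ∂gaussianReal 0 (A a a).toNNReal = 0 := integral_id_gaussianReal
        rw [← h1, integral_map (by fun_prop) (by fun_prop)] at h2
        exact h2
      have hmean : ∫ x, σ⁻¹ * (x i - r * x j) ∂μ = 0 := by
        rw [integral_const_mul, integral_sub ((hmem i).integrable one_le_two)
          (((hmem j).integrable one_le_two).const_mul r), integral_const_mul, hint, hint]
        simp
      have hvar : Var[fun x => σ⁻¹ * (x i - r * x j); μ] = 1 := by
        rw [variance_const_mul, variance_fun_sub (hmem i) ((hmem j).const_mul r),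
          variance_const_mul, covariance_const_mul_right, ← covariance_self (by fun_prop),
          ← covariance_self (by fun_prop), hcov, hcov, hcov, hi, hj, ← hrdef]
        field_simp
        linarith
      rw [hmean, hvar]
      simp
    rw [hXlaw, hWlaw] at hmap
    rw [← hmap, Measure.map_map (by fun_prop) (by fun_prop)]
    congr 1
    ext x
    · simp only [Function.comp_apply]
      field_simp
      ring
    · rfl
  | student df hdf =>
    obtain ⟨T, hT, hrow⟩ := exists_factor hA hi hj hr
    have hprob1 := isProbabilityMeasure_studentMeasure hdf
    have hprob2 : IsProbabilityMeasure (studentMeasure (df + 1)) :=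
      isProbabilityMeasure_studentMeasure (by positivity)
    set r := A i j with hrdef
    set σ := Real.sqrt (1 - r ^ 2) with hσ
    have hcond : (student df hdf).condLaw 1 = studentMeasure (df + 1) := by simp [condLaw]
    have hmarg : (student df hdf).margLaw = studentMeasure df := rfl
    rw [hcond, hmarg]
    have hpair : Measurable fun x : EuclideanSpace ℝ (Fin (n + 2)) => ((x i : ℝ), (x j : ℝ)) := by
      fun_prop
    have hq : Measurable fun q : ℝ × ℝ =>
        (r * q.1 + σ * (student df hdf).scaleFactor q.1 * q.2, q.1) := by fun_prop
    ext s hs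
    set f : ℝ × ℝ → ℝ≥0∞ := s.indicator 1 with hf
    have hfm : Measurable f := measurable_one.indicator hs
    rw [← lintegral_indicator_one hs, ← lintegral_indicator_one hs, ← hf,
      lintegral_map hfm hpair, lintegral_map hfm hq, lintegral_prod _ (by fun_prop)]
    simp only [mvLaw]
    have hden : Measurable fun x : EuclideanSpace ℝ (Fin (n + 2)) =>
        ENNReal.ofReal (mvStudentPDF df A fun a => x a) := by
      refine ((measurable_mvStudentPDF df A).comp ?_).ennreal_ofReal
      fun_prop
    rw [lintegral_withDensity_eq_lintegral_mul _ hden (by fun_prop)]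
    have hvp := EuclideanSpace.volume_preserving_symm_measurableEquiv_toLp (Fin (n + 2))
    rw [← hvp.symm.lintegral_comp_emb (MeasurableEquiv.measurableEmbedding _)]
    have hGm : Measurable (Function.uncurry fun x w : ℝ => f (r * x + σ * w, x)) := by
      unfold Function.uncurry
      fun_prop
    -- In the coordinates of `T` the pair depends on `z 0` and `z 1` only, so the spherical
    -- disintegration applies.
    have hstep := lintegral_mvStudentPDF df hA hT
      (F := fun x => f (x i, x j)) (by fun_prop)
    simp only [(hrow _).1, (hrow _).2] at hstep
    rw [lintegral_mvStudentPDF_one_fst_snd hdf n hGm] at hstep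
    simp only [scaleFactor, mul_assoc]
    rw [← hstep]
    refine lintegral_congr fun x => ?_
    simp only [Pi.mul_apply]
    rw [mul_comm]
    rfl

end Family

/-! ### Extended distribution functions and quantiles -/

section Quantile

variable {ν : Measure ℝ}

@[simp] lemma extCDF_bot : extCDF ν ⊥ = 0 := by simp [extCDF]

lemma extCDF_nonneg (x : EReal) : 0 ≤ extCDF ν x := measureReal_nonneg

lemma quantile_mono : Monotone (quantile ν) := fun _ _ h =>
  sInf_le_sInf fun _ hx => le_trans h hx

variable [IsProbabilityMeasure ν]

/-- A jump of the distribution function would be the mass of a point. -/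
lemma continuous_cdf [NullSingletonClass ν] : Continuous (cdf ν) := by
  refine continuous_iff_continuousAt.2 fun x => ?_
  rw [(monotone_cdf ν).continuousAt_iff_leftLim_eq_rightLim, StieltjesFunction.rightLim_eq]
  have h := StieltjesFunction.measure_singleton (cdf ν) x
  rw [measure_cdf, measure_singleton, eq_comm, ENNReal.ofReal_eq_zero] at h
  exact le_antisymm ((monotone_cdf ν).leftLim_le le_rfl) (by linarith)

@[simp] lemma extCDF_coe (x : ℝ) : extCDF ν x = cdf ν x := by
  simp [extCDF, cdf_eq_real, Iic_def]

@[simp] lemma extCDF_top : extCDF ν ⊤ = 1 := by simp [extCDF]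

lemma strictMono_extCDF [ν.IsOpenPosMeasure] : StrictMono (extCDF ν) := by
  intro a b hab
  obtain ⟨x, hax, hxb⟩ := EReal.lt_iff_exists_real_btwn.1 hab
  obtain ⟨y, hxy, hyb⟩ := EReal.lt_iff_exists_real_btwn.1 hxb
  have hxy' : x < y := by exact_mod_cast hxy
  have hsub : {t : ℝ | (t : EReal) ≤ a} ∪ Ioo x y ⊆ {t : ℝ | (t : EReal) ≤ b} := by
    rintro t (ht | ht)
    · exact le_trans ht hab.le
    · exact le_trans (by exact_mod_cast ht.2.le) hyb.le
  have hdisj : Disjoint {t : ℝ | (t : EReal) ≤ a} (Ioo x y) := by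
    rw [Set.disjoint_left]
    intro t ht ht'
    have : (t : EReal) < x := lt_of_le_of_lt ht hax
    exact absurd (by exact_mod_cast this) ht'.1.not_gt
  have h1 := measureReal_mono (μ := ν) hsub
  rw [measureReal_union hdisj measurableSet_Ioo] at h1
  have h2 : 0 < ν.real (Ioo x y) := ENNReal.toReal_pos
    (Measure.measure_Ioo_pos ν |>.2 hxy').ne' (measure_ne_top _ _)
  unfold extCDF
  linarith

lemma exists_extCDF_eq [NullSingletonClass ν] {u : ℝ} (h0 : 0 ≤ u) (h1 : u ≤ 1) :
    ∃ q, extCDF ν q = u := by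
  rcases h0.eq_or_lt with rfl | h0
  · exact ⟨⊥, extCDF_bot⟩
  rcases h1.eq_or_lt with rfl | h1
  · exact ⟨⊤, extCDF_top⟩
  obtain ⟨q, hq⟩ := mem_range_of_exists_le_of_exists_ge (c := u) (continuous_cdf (ν := ν))
    ((tendsto_cdf_atBot ν).eventually_le_const h0).exists
    ((tendsto_cdf_atTop ν).eventually_const_le h1).exists
  exact ⟨q, by simpa using hq⟩

/-- By strict monotonicity the set defining the quantile is `Ici q`; the values `q = ±∞` are
included. -/
lemma quantile_extCDF [ν.IsOpenPosMeasure] (q : EReal) : quantile ν (extCDF ν q) = q := by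
  unfold quantile
  simp only [strictMono_extCDF.le_iff_le]
  exact csInf_Ici

/-- The law of `F(Y)` is uniform when `Y` has the continuous distribution function `F`. -/
lemma measure_cdf_le [NullSingletonClass ν] {u : ℝ} (h0 : 0 ≤ u) (h1 : u ≤ 1) :
    ν {t | cdf ν t ≤ u} = ENNReal.ofReal u := by
  have key {v : ℝ} (h0 : 0 < v) (h1 : v < 1) : ν {t | cdf ν t ≤ v} = ENNReal.ofReal v := by
    obtain ⟨s, hs⟩ := mem_range_of_exists_le_of_exists_ge (c := v) (continuous_cdf (ν := ν))
      ((tendsto_cdf_atBot ν).eventually_le_const h0).exists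
      ((tendsto_cdf_atTop ν).eventually_const_le h1).exists
    have hne : {t | cdf ν t ≤ v}.Nonempty := ⟨s, hs.le⟩
    obtain ⟨b, hb⟩ := ((tendsto_cdf_atTop ν).eventually_const_lt h1).exists
    have hbdd : BddAbove {t | cdf ν t ≤ v} := ⟨b, fun t ht => by
      by_contra h
      exact absurd (lt_of_lt_of_le hb (monotone_cdf ν (not_le.1 h).le)) (not_lt.2 ht)⟩
    have hcl : IsClosed {t | cdf ν t ≤ v} := isClosed_le continuous_cdf continuous_const
    have hmem := hcl.csSup_mem hne hbdd
    -- The sublevel set is a closed ray, and its endpoint attains the level `v`.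
    have hset : {t | cdf ν t ≤ v} = Iic (sSup {t | cdf ν t ≤ v}) := by
      refine Subset.antisymm (fun t ht => le_csSup hbdd ht) fun t ht => ?_
      exact (monotone_cdf ν ht).trans hmem
    rw [hset, ← ofReal_cdf]
    congr 1
    refine le_antisymm hmem ?_
    exact hs.ge.trans (monotone_cdf ν (le_csSup hbdd hs.le))
  rcases h0.eq_or_lt with rfl | h0
  -- Level `0` need not be attained, so this case is squeezed by small positive levels.
  · rw [ENNReal.ofReal_zero]
    refine le_antisymm (le_of_forall_gt_imp_ge_of_dense fun a ha => ?_) (bot_le)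
    rcases le_or_gt 1 a with h | h
    · exact prob_le_one.trans h
    · have hat : a ≠ ∞ := (h.trans ENNReal.one_lt_top).ne
      have ha0 : 0 < a.toReal := ENNReal.toReal_pos ha.ne' hat
      have ha1 : a.toReal < 1 := by
        have := (ENNReal.toReal_lt_toReal hat ENNReal.one_ne_top).2 h
        simpa using this
      refine (measure_mono fun t (ht : cdf ν t ≤ 0) => ?_).trans
        ((key ha0 ha1).trans (ENNReal.ofReal_toReal hat)).le
      exact le_trans ht ha0.le
  rcases h1.eq_or_lt with rfl | h1
  · have : {t | cdf ν t ≤ 1} = univ := eq_univ_of_forall fun t => cdf_le_one ν t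
    simp [this]
  · exact key h0 h1

lemma ae_cdf_pos [NullSingletonClass ν] : ∀ᵐ t ∂ν, 0 < cdf ν t := by
  rw [ae_iff]
  simpa using measure_cdf_le (ν := ν) le_rfl zero_le_one

lemma ae_cdf_lt_one [NullSingletonClass ν] : ∀ᵐ t ∂ν, cdf ν t < 1 := by
  rw [ae_iff]
  simp only [not_lt]
  refine le_antisymm (ENNReal.le_of_forall_pos_le_add fun ε hε _ => ?_) (bot_le)
  rcases le_or_gt 1 (ε : ℝ) with h | h
  · refine prob_le_one.trans ?_
    rw [zero_add]
    exact_mod_cast h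
  have h1 := measure_cdf_le (ν := ν) (u := 1 - ε) (by linarith) (by linarith [ε.2])
  have h2 : MeasurableSet {t | cdf ν t ≤ 1 - ε} :=
    measurableSet_le continuous_cdf.measurable measurable_const
  have hε' : (0 : ℝ) < ε := hε
  refine (measure_mono (t := {t | cdf ν t ≤ 1 - ε}ᶜ) fun t (ht : 1 ≤ cdf ν t) => ?_).trans ?_
  · simp only [mem_compl_iff, mem_ofPred_eq, not_le]
    linarith
  · rw [prob_compl_eq_one_sub h2, h1, zero_add, ← ENNReal.ofReal_one,
      ← ENNReal.ofReal_sub _ (by linarith), sub_sub_cancel, ENNReal.ofReal_coe_nnreal]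

end Quantile

/-- Allowing `q = ±∞` means that the levels `0` and `1` of `F₁⁺` need no separate treatment later.
-/
lemma EReal_coe_le_sub_div_iff {σ : ℝ} (hσ : 0 < σ) (q : EReal) (m w : ℝ) :
    (w : EReal) ≤ (q - (m : EReal)) / (σ : EReal) ↔ ((m + σ * w : ℝ) : EReal) ≤ q := by
  have hσ' : (0 : EReal) < σ := by exact_mod_cast hσ
  induction q with
  | bot =>
    rw [EReal.bot_sub, EReal.bot_div_of_pos_ne_top hσ' (EReal.coe_ne_top _)]
    simp [-EReal.coe_add, -EReal.coe_mul]
  | top =>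
    rw [EReal.top_sub_coe, EReal.top_div_of_pos_ne_top hσ' (EReal.coe_ne_top _)]
    simp
  | coe q =>
    rw [← EReal.coe_sub, ← EReal.coe_div, EReal.coe_le_coe_iff, EReal.coe_le_coe_iff,
      le_div_iff₀ hσ]
    constructor <;> intro h <;> linarith

/-! ### The quantile transform between continuous laws -/

section Transform

variable {ν μ : Measure ℝ} [IsProbabilityMeasure ν] [NullSingletonClass ν] [ν.IsOpenPosMeasure]
  [IsProbabilityMeasure μ] [NullSingletonClass μ]

lemma cdf_toReal_quantile {u : ℝ} (h0 : 0 < u) (h1 : u < 1) :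
    cdf ν (quantile ν u).toReal = u := by
  obtain ⟨q, hq⟩ := exists_extCDF_eq (ν := ν) h0.le h1.le
  rw [← hq, quantile_extCDF]
  induction q with
  | bot => rw [extCDF_bot] at hq; exact absurd hq h0.ne
  | top => rw [extCDF_top] at hq; exact absurd hq h1.ne'
  | coe q => simp

variable (ν μ) in
-- `cdf μ` sends `μ` to the uniform law and the quantile function sends that to `ν`. Almost surely
-- the level lies in `(0, 1)`, so `toReal` loses nothing.
lemma map_quantile_cdf : μ.map (fun t => (quantile ν (cdf μ t)).toReal) = ν := by
  have hψ : Measurable fun t => (quantile ν (cdf μ t)).toReal :=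
    measurable_ereal_toReal.comp
      ((quantile_mono (ν := ν)).measurable.comp (monotone_cdf μ).measurable)
  have := Measure.isProbabilityMeasure_map (μ := μ) hψ.aemeasurable
  refine Measure.ext_of_Iic _ _ fun x => ?_
  rw [Measure.map_apply hψ measurableSet_Iic, ← ofReal_cdf,
    ← measure_cdf_le (ν := μ) (cdf_nonneg ν x) (cdf_le_one ν x)]
  refine measure_congr ?_
  filter_upwards [ae_cdf_pos (ν := μ), ae_cdf_lt_one (ν := μ)] with t h0 h1
  refine propext ?_
  change (quantile ν (cdf μ t)).toReal ≤ x ↔ cdf μ t ≤ cdf ν x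
  conv_rhs => rw [← cdf_toReal_quantile (ν := ν) h0 h1]
  rw [← extCDF_coe (ν := ν), ← extCDF_coe (ν := ν), strictMono_extCDF.le_iff_le, EReal.coe_le_coe_iff]

lemma setLIntegral_cdf_le {G : ℝ → ℝ≥0∞} (hG : Measurable G) (y : ℝ) :
    ∫⁻ x in {x | cdf ν x ≤ cdf μ y}, G x ∂ν =
      ∫⁻ t in Iic y, G (quantile ν (cdf μ t)).toReal ∂μ := by
  have hψ : Measurable fun t => (quantile ν (cdf μ t)).toReal :=
    measurable_ereal_toReal.comp
      ((quantile_mono (ν := ν)).measurable.comp (monotone_cdf μ).measurable)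
  have hs : MeasurableSet {x | cdf ν x ≤ cdf μ y} :=
    measurableSet_le continuous_cdf.measurable measurable_const
  have hmap : ∫⁻ x in {x | cdf ν x ≤ cdf μ y}, G x ∂ν = ∫⁻ x in {x | cdf ν x ≤ cdf μ y}, G x
      ∂(μ.map fun t => (quantile ν (cdf μ t)).toReal) := by rw [map_quantile_cdf ν μ]
  rw [hmap, setLIntegral_map hs hG hψ]
  refine setLIntegral_congr ?_
  -- These sets differ where `cdf μ` is flat to the right of `y`, which is null because both have
  -- mass `cdf μ y`.
  have h1 : Iic y =ᵐ[μ] {t | cdf μ t ≤ cdf μ y} := by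
    refine ae_eq_of_subset_of_measure_ge (fun t ht => monotone_cdf μ ht) ?_
      measurableSet_Iic.nullMeasurableSet (measure_ne_top _ _)
    rw [measure_cdf_le (cdf_nonneg μ y) (cdf_le_one μ y), ofReal_cdf]
  refine Filter.EventuallyEq.trans ?_ h1.symm
  filter_upwards [ae_cdf_pos (ν := μ), ae_cdf_lt_one (ν := μ)] with t h0 h1
  change (cdf ν (quantile ν (cdf μ t)).toReal ≤ cdf μ y) = (cdf μ t ≤ cdf μ y)
  rw [cdf_toReal_quantile h0 h1]

end Transform

namespace Family

instance (c : Family) : NullSingletonClass c.margLaw := by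
  cases c with
  | gaussian => exact nullSingletonClass_gaussianReal one_ne_zero
  | student df hdf => simp only [margLaw, studentMeasure]; infer_instance

instance (c : Family) : c.margLaw.IsOpenPosMeasure := by
  cases c with
  | gaussian =>
    exact (gaussianReal_absolutelyContinuous' 0 one_ne_zero).isOpenPosMeasure
  | student df hdf =>
    refine Measure.AbsolutelyContinuous.isOpenPosMeasure (μ := (volume : Measure ℝ)) ?_
    refine withDensity_absolutelyContinuous' (by fun_prop) (ae_of_all _ fun x => ?_)
    simpa using studentPDF_pos hdf x

end Family

/-! ### Correlation matrices -/

@[simp] lemma fullCorr_zero_zero (z : CorrType) (ρ₁ ρ₂ : ℝ) (k : ℕ) :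
    fullCorr z ρ₁ ρ₂ k 0 0 = 1 := rfl

@[simp] lemma fullCorr_zero_succ (z : CorrType) (ρ₁ ρ₂ : ℝ) (k : ℕ) (i : Fin k) :
    fullCorr z ρ₁ ρ₂ k 0 i.succ = ρ₁ := rfl

@[simp] lemma fullCorr_succ_zero (z : CorrType) (ρ₁ ρ₂ : ℝ) (k : ℕ) (i : Fin k) :
    fullCorr z ρ₁ ρ₂ k i.succ 0 = ρ₁ := rfl

@[simp] lemma fullCorr_succ_succ (z : CorrType) (ρ₁ ρ₂ : ℝ) (k : ℕ) (i j : Fin k) :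
    fullCorr z ρ₁ ρ₂ k i.succ j.succ = sevCorr z ρ₂ k i j := rfl

@[simp] lemma sevCorr_self (z : CorrType) (ρ₂ : ℝ) (k : ℕ) (i : Fin k) :
    sevCorr z ρ₂ k i i = 1 := by
  cases z <;> simp [sevCorr]

lemma sevCorr_one (z : CorrType) (ρ₂ : ℝ) : sevCorr z ρ₂ 1 = 1 := by
  ext i j
  rw [Subsingleton.elim j i, sevCorr_self, Matrix.one_apply_eq]

/-- Completing the square writes the quadratic form as a sum of three nonnegative terms; `ρ₁² < ρ₂`
handles the second and `ρ₂ < 1` the third. -/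
lemma posDef_fullCorr_equi {ρ₁ ρ₂ : ℝ} (h : ρ₁ ^ 2 < ρ₂) (h1 : ρ₂ < 1) (k : ℕ) :
    (fullCorr .equi ρ₁ ρ₂ k).PosDef := by
  refine Matrix.PosDef.of_dotProduct_mulVec_pos ?_ fun x hx => ?_
  · refine Matrix.IsHermitian.ext fun i j => ?_
    refine Fin.cases ?_ (fun i => ?_) i <;> refine Fin.cases ?_ (fun j => ?_) j <;>
      simp [sevCorr, eq_comm]
  set s := ∑ i : Fin k, x i.succ with hs
  have hrow (i : Fin k) : ∑ j : Fin k, sevCorr .equi ρ₂ k i j * x j.succ =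
      ρ₂ * s + (1 - ρ₂) * x i.succ := by
    have : ∀ j : Fin k, sevCorr .equi ρ₂ k i j * x j.succ =
        ρ₂ * x j.succ + if i = j then (1 - ρ₂) * x j.succ else 0 := by
      intro j
      simp only [sevCorr, Matrix.of_apply]
      split_ifs <;> ring
    simp only [this, Finset.sum_add_distrib, ← Finset.mul_sum, Finset.sum_ite_eq,
      Finset.mem_univ, if_true, hs]
  have hval : star x ⬝ᵥ (fullCorr .equi ρ₁ ρ₂ k *ᵥ x) =
      (x 0 + ρ₁ * s) ^ 2 + (ρ₂ - ρ₁ ^ 2) * s ^ 2 + (1 - ρ₂) * ∑ i : Fin k, x i.succ ^ 2 := by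
    simp only [dotProduct, Matrix.mulVec, Fin.sum_univ_succ, star_trivial, fullCorr_zero_zero,
      fullCorr_zero_succ, fullCorr_succ_zero, fullCorr_succ_succ, hrow, ← Finset.mul_sum, ← hs]
    have e : ∀ i : Fin k, x i.succ * (ρ₁ * x 0 + (ρ₂ * s + (1 - ρ₂) * x i.succ)) =
        (ρ₁ * x 0 + ρ₂ * s) * x i.succ + (1 - ρ₂) * x i.succ ^ 2 := fun i => by ring
    simp only [e, Finset.sum_add_distrib, ← Finset.mul_sum, ← hs]
    ring
  rw [hval]
  have hsq : 0 ≤ ∑ i : Fin k, x i.succ ^ 2 := Finset.sum_nonneg fun i _ => sq_nonneg _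
  -- Either the third term is positive, or all severity coordinates vanish and `x 0 ^ 2` remains.
  by_cases hzero : ∑ i : Fin k, x i.succ ^ 2 = 0
  · have hx' : ∀ i : Fin k, x i.succ = 0 := fun i => by
      have := (Finset.sum_eq_zero_iff_of_nonneg fun i _ => sq_nonneg (x (Fin.succ i))).1 hzero i
        (Finset.mem_univ i)
      simpa using this
    have hs0 : s = 0 := by simp [hs, hx']
    have hx0 : x 0 ≠ 0 := fun h0 => hx (by
      ext i
      refine Fin.cases h0 hx' i)
    rw [hzero, hs0]
    have := pow_pos (abs_pos.2 hx0) 2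
    rw [sq_abs] at this
    simpa using this
  · have h2 : 0 < (1 - ρ₂) * ∑ i : Fin k, x i.succ ^ 2 :=
      mul_pos (by linarith) (lt_of_le_of_ne hsq (Ne.symm hzero))
    have h3 : 0 ≤ (ρ₂ - ρ₁ ^ 2) * s ^ 2 := mul_nonneg (by linarith) (sq_nonneg _)
    have h4 := sq_nonneg (x 0 + ρ₁ * s)
    linarith

/-- The total mass is read off from the law of a pair of coordinates, so the multivariate
normalising constant is never integrated directly. -/
lemma Family.isProbabilityMeasure_mvLaw (c : Family) {n : ℕ}
    {A : Matrix (Fin (n + 2)) (Fin (n + 2)) ℝ} (hA : A.PosDef) {i j : Fin (n + 2)}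
    (hi : A i i = 1) (hj : A j j = 1) (hr : A i j ^ 2 < 1) :
    IsProbabilityMeasure (c.mvLaw A) := by
  have h := c.map_mvLaw_pair hA hi hj hr
  have hm : Measurable fun q : ℝ × ℝ =>
      (A i j * q.1 + Real.sqrt (1 - A i j ^ 2) * c.scaleFactor q.1 * q.2, q.1) := by fun_prop
  have := Measure.isProbabilityMeasure_map
    (μ := c.margLaw.prod (c.condLaw 1)) hm.aemeasurable
  rw [← h] at this
  refine ⟨?_⟩
  have hu := measure_univ (μ := (c.mvLaw A).map fun x => (x i, x j))
  rwa [Measure.map_apply (by fun_prop) MeasurableSet.univ, preimage_univ] at hu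

/-! ### The bivariate density -/

lemma Family.margPDF_pos (c : Family) (x : ℝ) : 0 < c.margPDF x := by
  cases c with
  | gaussian => exact gaussianPDFReal_pos _ _ _ one_ne_zero
  | student df hdf => exact studentPDF_pos hdf x

lemma Family.mvPDF_one (c : Family) (x : Fin 1 → ℝ) : c.mvPDF 1 x = c.margPDF (x 0) := by
  cases c with
  | gaussian =>
    simp only [Family.mvPDF, Family.margPDF, mvNormalPDF, gaussianPDFReal]
    simp [dotProduct, Real.sqrt_eq_rpow, sq]
  | student df hdf =>
    simp only [Family.mvPDF, Family.margPDF, studentPDF, mvStudentPDF_one]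
    simp [dotProduct, Real.sqrt_eq_rpow, sq, add_comm]

namespace Params

variable (θ : Params)

/-- The score `Φ⁻¹(F₂(y))` of a single severity. -/
noncomputable def score (y : ℝ) : ℝ := (quantile θ.fam.margLaw (θ.F₂ y)).toReal

@[fun_prop]
lemma measurable_score : Measurable θ.score :=
  measurable_ereal_toReal.comp
    ((quantile_mono (ν := θ.fam.margLaw)).measurable.comp (monotone_cdf θ.sevLaw).measurable)

/-- A one-dimensional copula density is identically one. -/
lemma sevPDF_one (y : ℝ) : θ.sevPDF ![y] = θ.f₂ y := by
  have := (Family.margPDF_pos θ.fam (θ.score y)).ne'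
  unfold sevPDF Family.copulaPDF
  rw [sevCorr_one, Family.mvPDF_one]
  simp only [Fin.prod_univ_one, Matrix.cons_val_zero]
  change θ.fam.margPDF (θ.score y) / θ.fam.margPDF (θ.score y) * θ.f₂ y = θ.f₂ y
  rw [div_self this, one_mul]

lemma condLoc_one (y : ℝ) : θ.condLoc ![y] = θ.ρ₁ * θ.score y := by
  simp [condLoc, sevCorr_one, dotProduct, scores, score]

lemma condScale_one (y : ℝ) :
    θ.condScale ![y] = Real.sqrt (1 - θ.ρ₁ ^ 2) * θ.fam.scaleFactor (θ.score y) := by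
  unfold condScale
  simp only [sevCorr_one, inv_one, Matrix.one_mulVec, dotProduct, Fin.sum_univ_one, scores,
    Matrix.cons_val_zero, ← sq]
  change _ * (match θ.fam with
    | .gaussian => 1
    | .student df _ => Real.sqrt ((df + θ.score y ^ 2) / (df + (1 : ℕ)))) = _
  cases θ.fam <;> simp [Family.scaleFactor]

/-- The conditional probability of the first score being below level `u` given the second. -/
noncomputable def condProb (u x : ℝ) : ℝ≥0∞ :=
  θ.fam.condLaw 1 {w | cdf θ.fam.margLaw
    (θ.ρ₁ * x + Real.sqrt (1 - θ.ρ₁ ^ 2) * θ.fam.scaleFactor x * w) ≤ u}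

lemma measurableSet_condProb (u : ℝ) : MeasurableSet {q : ℝ × ℝ | cdf θ.fam.margLaw
    (θ.ρ₁ * q.1 + Real.sqrt (1 - θ.ρ₁ ^ 2) * θ.fam.scaleFactor q.1 * q.2) ≤ u} := by
  refine measurableSet_le ?_ measurable_const
  exact (continuous_cdf (ν := θ.fam.margLaw)).measurable.comp (by fun_prop)

@[fun_prop]
lemma measurable_condProb (u : ℝ) : Measurable (θ.condProb u) :=
  measurable_measure_prodMk_left (θ.measurableSet_condProb u)

/-- Writing `u` as the distribution function at an extended real `q` makes both sides the mass of
the event `ρ₁ x + σ w ≤ q`. -/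
lemma ofReal_condCDFAt_one (hρ : θ.ρ₁ ^ 2 < 1) {u : ℝ} (h0 : 0 ≤ u) (h1 : u ≤ 1) (y : ℝ) :
    ENNReal.ofReal (θ.condCDFAt u ![y]) = θ.condProb u (θ.score y) := by
  obtain ⟨q, rfl⟩ := exists_extCDF_eq (ν := θ.fam.margLaw) h0 h1
  have hpos : 0 < Real.sqrt (1 - θ.ρ₁ ^ 2) * θ.fam.scaleFactor (θ.score y) :=
    mul_pos (Real.sqrt_pos.2 (by linarith)) (θ.fam.scaleFactor_pos _)
  unfold condCDFAt condProb
  rw [quantile_extCDF, condLoc_one, condScale_one, extCDF, ofReal_measureReal]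
  congr 1
  ext w
  change (w : EReal) ≤ _ ↔ cdf θ.fam.margLaw _ ≤ extCDF θ.fam.margLaw q
  rw [EReal_coe_le_sub_div_iff hpos, ← extCDF_coe, strictMono_extCDF.le_iff_le]

lemma condCDFAt_one_nonneg (u : ℝ) (y : ℝ) : 0 ≤ θ.condCDFAt u ![y] := extCDF_nonneg _

lemma condCDFAt_one_mono (hρ : θ.ρ₁ ^ 2 < 1) {u v : ℝ} (hu : 0 ≤ u) (huv : u ≤ v) (hv : v ≤ 1)
    (y : ℝ) : θ.condCDFAt u ![y] ≤ θ.condCDFAt v ![y] := by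
  rw [← ENNReal.ofReal_le_ofReal_iff (θ.condCDFAt_one_nonneg v y),
    θ.ofReal_condCDFAt_one hρ hu (huv.trans hv), θ.ofReal_condCDFAt_one hρ (hu.trans huv) hv]
  exact measure_mono fun w hw => le_trans hw huv

end Params

/-! ### The law of the frequency and a single severity -/

section Model

variable {Ω : Type*} [MeasurableSpace Ω] {P : Measure Ω}
  {θ : Params} {Nplus : Ω → ℕ} {Y : ℕ → Ω → ℝ} {R : Ω → Bool}

lemma freqCDF_nonneg (x : ℝ) : 0 ≤ freqCDF P Nplus x := cdf_nonneg _ _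

lemma freqCDF_le_one (x : ℝ) : freqCDF P Nplus x ≤ 1 := cdf_le_one _ _

lemma freqCDF_mono {x y : ℝ} (h : x ≤ y) : freqCDF P Nplus x ≤ freqCDF P Nplus y :=
  monotone_cdf _ h

namespace IsModel

lemma rho_sq_lt (h : IsModel θ P Nplus Y R) : θ.ρ₁ ^ 2 < 1 := by
  have := h.ρ₁_mem
  rw [sq_lt_one_iff_abs_lt_one, abs_lt]
  exact this

lemma posDef_fullCorr (h : IsModel θ P Nplus Y R) {k : ℕ} (hk : 0 < k)
    (hP : 0 < P {ω | k ≤ Nplus ω}) : (fullCorr θ.z θ.ρ₁ θ.ρ₂ k).PosDef := by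
  rcases hz : θ.z with _ | _
  · exact posDef_fullCorr_equi (h.equi_cond hz) h.ρ₂_mem.2 k
  · rw [← hz]
    exact h.autoreg_posDef hz k hk hP

lemma isProbabilityMeasure_sevLaw (h : IsModel θ P Nplus Y R) :
    IsProbabilityMeasure θ.sevLaw := ⟨h.sevLaw_univ⟩

end IsModel

instance (θ : Params) : NullSingletonClass θ.sevLaw := by
  unfold Params.sevLaw
  infer_instance

lemma hPDF_eq (θ : Params) (n : ℕ) (y : ℝ) :
    hPDF θ P Nplus n y = θ.f₂ y * (θ.condCDFAt (freqCDF P Nplus n) ![y] -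
      θ.condCDFAt (freqCDF P Nplus ((n : ℝ) - 1)) ![y]) := by
  simp only [hPDF, Params.jointPDF, Params.sevPDF_one, Int.cast_natCast]

lemma IsModel.hPDF_nonneg (h : IsModel θ P Nplus Y R) (n : ℕ) (y : ℝ) :
    0 ≤ hPDF θ P Nplus n y := by
  rw [hPDF_eq]
  refine mul_nonneg (h.f₂_nonneg y) (sub_nonneg.2 ?_)
  exact θ.condCDFAt_one_mono h.rho_sq_lt (freqCDF_nonneg _) (freqCDF_mono (by linarith))
    (freqCDF_le_one _) y

lemma IsModel.measurable_hPDF (h : IsModel θ P Nplus Y R) (n : ℕ) :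
    Measurable (hPDF θ P Nplus n) := by
  have hc {u : ℝ} (h0 : 0 ≤ u) (h1 : u ≤ 1) : Measurable fun y => θ.condCDFAt u ![y] := by
    have : (fun y => θ.condCDFAt u ![y]) = fun y => (θ.condProb u (θ.score y)).toReal := by
      ext y
      rw [← θ.ofReal_condCDFAt_one h.rho_sq_lt h0 h1,
        ENNReal.toReal_ofReal (θ.condCDFAt_one_nonneg u y)]
    rw [this]
    exact ((θ.measurable_condProb u).comp θ.measurable_score).ennreal_toReal
  have := hc (freqCDF_nonneg (P := P) (Nplus := Nplus) n) (freqCDF_le_one _)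
  have := hc (freqCDF_nonneg (P := P) (Nplus := Nplus) ((n : ℝ) - 1)) (freqCDF_le_one _)
  have := h.measurable_f₂
  rw [show hPDF θ P Nplus n = _ from funext (hPDF_eq θ n)]
  fun_prop

variable [IsProbabilityMeasure P]

/-- The margin of the copula identity for the frequency and the severity `Y j`. -/
lemma IsModel.real_le_le (h : IsModel θ P Nplus Y R) {k : ℕ}
    (hP : 0 < P {ω | k + 1 ≤ Nplus ω}) (j : Fin (k + 1)) (n : ℕ) (y : ℝ) :
    P.real {ω | Nplus ω ≤ n ∧ Y j ω ≤ y} =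
      (θ.fam.mvLaw (fullCorr θ.z θ.ρ₁ θ.ρ₂ (k + 1))).real
        {x | cdf θ.fam.margLaw (x 0) ≤ freqCDF P Nplus n ∧
          cdf θ.fam.margLaw (x j.succ) ≤ θ.F₂ y} := by
  have hA := h.posDef_fullCorr k.succ_pos hP
  have hprob := θ.fam.isProbabilityMeasure_mvLaw hA (i := 0) (j := j.succ) (by simp) (by simp)
    (by simpa using h.rho_sq_lt)
  -- All severity arguments except the `j`-th are set to `M`, and `M` tends to infinity on both
  -- sides of the copula identity.
  let v : ℕ → Fin (k + 1) → ℝ := fun M => Function.update (fun _ => (M : ℝ)) j y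
  have hv : Monotone v := fun a b hab i => by
    rcases eq_or_ne i j with rfl | hij
    · simp [v]
    · simpa [v, hij] using hab
  have hvj (M : ℕ) : v M j = y := by simp [v]
  have hvi (M : ℕ) {i : Fin (k + 1)} (hi : i ≠ j) : v M i = M := by simp [v, hi]
  have hl : Filter.Tendsto (fun M => P.real {ω | Nplus ω ≤ n ∧ ∀ i : Fin (k + 1), Y i ω ≤ v M i})
      Filter.atTop (nhds (P.real {ω | Nplus ω ≤ n ∧ Y j ω ≤ y})) := by
    have hU : {ω | Nplus ω ≤ n ∧ Y j ω ≤ y} =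
        ⋃ M, {ω | Nplus ω ≤ n ∧ ∀ i : Fin (k + 1), Y i ω ≤ v M i} := by
      ext ω
      simp only [mem_iUnion, mem_ofPred_eq]
      constructor
      · rintro ⟨h1, h2⟩
        obtain ⟨M, hM⟩ := exists_nat_ge (∑ i : Fin (k + 1), |Y i ω|)
        refine ⟨M, h1, fun i => ?_⟩
        rcases eq_or_ne i j with rfl | hij
        · rwa [hvj]
        · rw [hvi M hij]
          refine (le_abs_self _).trans (le_trans ?_ hM)
          exact Finset.single_le_sum (f := fun i : Fin (k + 1) => |Y i ω|)
            (fun i _ => abs_nonneg _) (Finset.mem_univ i)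
      · rintro ⟨M, h1, h2⟩
        exact ⟨h1, (h2 j).trans (hvj M).le⟩
    rw [hU]
    refine (ENNReal.tendsto_toReal (measure_ne_top _ _)).comp (tendsto_measure_iUnion_atTop ?_)
    exact fun a b hab ω hω => ⟨hω.1, fun i => (hω.2 i).trans (hv hab i)⟩
  have hr : Filter.Tendsto (fun M => θ.fam.copula (fullCorr θ.z θ.ρ₁ θ.ρ₂ (k + 1))
        (Fin.cons (freqCDF P Nplus n) fun i => θ.F₂ (v M i)))
      Filter.atTop (nhds ((θ.fam.mvLaw (fullCorr θ.z θ.ρ₁ θ.ρ₂ (k + 1))).real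
        {x | cdf θ.fam.margLaw (x 0) ≤ freqCDF P Nplus n ∧
          cdf θ.fam.margLaw (x j.succ) ≤ θ.F₂ y})) := by
    -- Strictness matters: `F₂ M` tends to `1` but need not reach it.
    have hlt (x : ℝ) : cdf θ.fam.margLaw x < 1 := by
      rw [← extCDF_coe, ← extCDF_top (ν := θ.fam.margLaw)]
      exact strictMono_extCDF (EReal.coe_lt_top x)
    have hU : {x : EuclideanSpace ℝ (Fin (k + 2)) |
          cdf θ.fam.margLaw (x 0) ≤ freqCDF P Nplus n ∧
          cdf θ.fam.margLaw (x j.succ) ≤ θ.F₂ y} =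
        ⋃ M, {x | ∀ i, cdf θ.fam.margLaw (x i) ≤
          (Fin.cons (freqCDF P Nplus n) fun i => θ.F₂ (v M i) : Fin (k + 2) → ℝ) i} := by
      ext x
      simp only [mem_iUnion, mem_ofPred_eq, Fin.forall_fin_succ (n := k + 1), Fin.cons_zero,
        Fin.cons_succ]
      constructor
      · rintro ⟨h1, h2⟩
        have hev : ∀ᶠ M : ℕ in Filter.atTop, ∀ i : Fin (k + 1),
            cdf θ.fam.margLaw (x i.succ) ≤ θ.F₂ M := by
          rw [Filter.eventually_all]
          intro i
          exact ((tendsto_cdf_atTop θ.sevLaw).comp tendsto_natCast_atTop_atTop).eventually_const_le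
            (hlt _)
        obtain ⟨M, hM⟩ := hev.exists
        refine ⟨M, h1, fun i => ?_⟩
        rcases eq_or_ne i j with rfl | hij
        · rwa [hvj]
        · rw [hvi M hij]
          exact hM i
      · rintro ⟨M, h1, h2⟩
        refine ⟨h1, ?_⟩
        have := h2 j
        rwa [hvj] at this
    rw [hU]
    refine (ENNReal.tendsto_toReal (measure_ne_top _ _)).comp (tendsto_measure_iUnion_atTop ?_)
    intro a b hab x hx i
    refine (hx i).trans ?_
    refine Fin.cases le_rfl (fun i => ?_) i
    exact monotone_cdf θ.sevLaw (hv hab i)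
  refine tendsto_nhds_unique hl (hr.congr fun M => ?_)
  exact (h.joint (k + 1) k.succ_pos hP n (v M)).symm

lemma Family.measure_pair_le (c : Family) {n : ℕ} {A : Matrix (Fin (n + 2)) (Fin (n + 2)) ℝ}
    (hA : A.PosDef) {i j : Fin (n + 2)} (hi : A i i = 1) (hj : A j j = 1) (hr : A i j ^ 2 < 1)
    (u v : ℝ) :
    c.mvLaw A {x | cdf c.margLaw (x i) ≤ u ∧ cdf c.margLaw (x j) ≤ v} =
      ∫⁻ x in {x | cdf c.margLaw x ≤ v}, c.condLaw 1 {w | cdf c.margLaw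
        (A i j * x + Real.sqrt (1 - A i j ^ 2) * c.scaleFactor x * w) ≤ u} ∂c.margLaw := by
  have hΦ : Measurable (cdf c.margLaw) := continuous_cdf.measurable
  have hs : MeasurableSet {q : ℝ × ℝ | cdf c.margLaw q.1 ≤ u ∧ cdf c.margLaw q.2 ≤ v} :=
    (measurableSet_le (hΦ.comp measurable_fst) measurable_const).inter
      (measurableSet_le (hΦ.comp measurable_snd) measurable_const)
  have hv : MeasurableSet {x | cdf c.margLaw x ≤ v} := measurableSet_le hΦ measurable_const
  have hm : Measurable fun q : ℝ × ℝ =>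
      (A i j * q.1 + Real.sqrt (1 - A i j ^ 2) * c.scaleFactor q.1 * q.2, q.1) := by fun_prop
  have h := congrArg (fun μ => μ {q : ℝ × ℝ | cdf c.margLaw q.1 ≤ u ∧ cdf c.margLaw q.2 ≤ v})
    (c.map_mvLaw_pair hA hi hj hr)
  simp only at h
  rw [Measure.map_apply (by fun_prop) hs, Measure.map_apply hm hs,
    Measure.prod_apply (hm hs)] at h
  refine h.trans ?_
  rw [← lintegral_indicator hv]
  refine lintegral_congr fun x => ?_
  by_cases hx : x ∈ {x | cdf c.margLaw x ≤ v}
  · rw [indicator_of_mem hx]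
    congr 1
    ext w
    exact ⟨fun hw => hw.1, fun hw => ⟨hw, hx⟩⟩
  · rw [indicator_of_notMem hx]
    convert measure_empty (μ := c.condLaw 1)
    ext w
    exact ⟨fun hw => hx hw.2, fun hw => hw.elim⟩

/-- The copula identity is used in dimension `k = j + 1`, the smallest that contains `Y j`, and the
measures are compared on half-lines. -/
lemma IsModel.map_restrict_le (h : IsModel θ P Nplus Y R) {j : ℕ}
    (hP : 0 < P {ω | j + 1 ≤ Nplus ω}) (n : ℕ) :
    (P.restrict {ω | Nplus ω ≤ n}).map (Y j) =
      volume.withDensity fun y =>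
        ENNReal.ofReal (θ.f₂ y * θ.condCDFAt (freqCDF P Nplus n) ![y]) := by
  have hsev := h.isProbabilityMeasure_sevLaw
  have hA := h.posDef_fullCorr j.succ_pos hP
  refine Measure.ext_of_Iic _ _ fun y => ?_
  have h1 := h.real_le_le hP (Fin.last j) n y
  have hprob := θ.fam.isProbabilityMeasure_mvLaw hA (i := 0) (j := (Fin.last j).succ)
    (by simp) (by rw [fullCorr_succ_succ, sevCorr_self])
    (by simpa only [fullCorr_zero_succ] using h.rho_sq_lt)
  rw [measureReal_def, measureReal_def,
    ENNReal.toReal_eq_toReal_iff' (measure_ne_top _ _) (measure_ne_top _ _),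
    θ.fam.measure_pair_le hA (by simp)
      (by rw [fullCorr_succ_succ, sevCorr_self])
      (by simpa only [fullCorr_zero_succ] using h.rho_sq_lt)] at h1
  rw [Measure.map_apply (h.measurable_Y j) measurableSet_Iic,
    Measure.restrict_apply (h.measurable_Y j measurableSet_Iic), inter_comm]
  refine h1.trans ?_
  simp only [fullCorr_zero_succ]
  change ∫⁻ x in {x | cdf θ.fam.margLaw x ≤ cdf θ.sevLaw y},
    θ.condProb (freqCDF P Nplus n) x ∂θ.fam.margLaw = _
  rw [setLIntegral_cdf_le (by fun_prop), withDensity_apply _ measurableSet_Iic, Params.sevLaw,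
    setLIntegral_withDensity_eq_setLIntegral_mul _ h.measurable_f₂.ennreal_ofReal _
      measurableSet_Iic]
  · refine lintegral_congr fun t => ?_
    rw [ENNReal.ofReal_mul (h.f₂_nonneg t),
      θ.ofReal_condCDFAt_one h.rho_sq_lt (freqCDF_nonneg _) (freqCDF_le_one _)]
    rfl
  · exact (θ.measurable_condProb _).comp θ.measurable_score

/-- On the event `N⁺ = n` each of the first `n` severities has density `h n`. -/
lemma IsModel.map_restrict_eq (h : IsModel θ P Nplus Y R) {n j : ℕ} (hj : j < n)
    (hP : 0 < P {ω | j + 1 ≤ Nplus ω}) :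
    (P.restrict {ω | Nplus ω = n}).map (Y j) =
      volume.withDensity fun y => ENNReal.ofReal (hPDF θ P Nplus n y) := by
  obtain ⟨m, rfl⟩ : ∃ m, n = m + 1 := ⟨n - 1, by omega⟩
  have hle (n : ℕ) : MeasurableSet {ω | Nplus ω ≤ n} :=
    measurableSet_le h.measurable_Nplus measurable_const
  have heq (n : ℕ) : MeasurableSet {ω | Nplus ω = n} :=
    h.measurable_Nplus (measurableSet_singleton n)
  have hsplit : (P.restrict {ω | Nplus ω ≤ m + 1}).map (Y j) =
      (P.restrict {ω | Nplus ω ≤ m}).map (Y j) + (P.restrict {ω | Nplus ω = m + 1}).map (Y j) := by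
    rw [← Measure.map_add _ _ (h.measurable_Y j), ← Measure.restrict_union _ (heq _)]
    · congr 2
      ext ω
      simp only [mem_ofPred_eq, mem_union]
      omega
    · rw [Set.disjoint_left]
      intro ω h1 h2
      simp only [mem_ofPred_eq] at h1 h2
      omega
  rw [h.map_restrict_le hP, h.map_restrict_le hP] at hsplit
  -- Finiteness allows this measure to be cancelled from both decompositions of the law on `N⁺ ≤ m +
  -- 1`.
  have hfin : IsFiniteMeasure (volume.withDensity fun y =>
      ENNReal.ofReal (θ.f₂ y * θ.condCDFAt (freqCDF P Nplus m) ![y])) := by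
    rw [← h.map_restrict_le hP]
    infer_instance
  have hdens : (volume.withDensity fun y =>
      ENNReal.ofReal (θ.f₂ y * θ.condCDFAt (freqCDF P Nplus (m + 1 : ℕ)) ![y])) =
      (volume.withDensity fun y =>
        ENNReal.ofReal (θ.f₂ y * θ.condCDFAt (freqCDF P Nplus m) ![y])) +
      volume.withDensity fun y => ENNReal.ofReal (hPDF θ P Nplus (m + 1 : ℕ) y) := by
    rw [← withDensity_add_right _ (h.measurable_hPDF _).ennreal_ofReal]
    congr 1
    ext y
    simp only [Pi.add_apply]
    rw [← ENNReal.ofReal_add (mul_nonneg (h.f₂_nonneg y) (θ.condCDFAt_one_nonneg _ y))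
      (h.hPDF_nonneg _ y), hPDF_eq]
    congr 1
    have : ((m + 1 : ℕ) : ℝ) - 1 = m := by push_cast; ring
    rw [this]
    ring
  rw [hdens] at hsplit
  ext s hs
  have hs' := congrArg (fun μ => μ s) hsplit
  simp only [Measure.add_apply] at hs'
  exact ((ENNReal.add_right_inj (measure_ne_top _ s)).1 hs').symm

end Model

section Moments

variable {Ω : Type*} [MeasurableSpace Ω] {P : Measure Ω}
  {θ : Params} {Nplus : Ω → ℕ} {Y : ℕ → Ω → ℝ} {R : Ω → Bool}

/-! ### Partial moments of a single severity -/

/-- The partial mean `∫ y h(n, y) dy` of a severity, with values in `[0, ∞]`. -/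
noncomputable def partialMean (θ : Params) (P : Measure Ω) (Nplus : Ω → ℕ) (n : ℕ) : ℝ≥0∞ :=
  ∫⁻ y in Ioi (0 : ℝ), ENNReal.ofReal (y * hPDF θ P Nplus n y)

namespace IsModel

lemma measurableSet_eq (h : IsModel θ P Nplus Y R) (n : ℕ) : MeasurableSet {ω | Nplus ω = n} :=
  h.measurable_Nplus (measurableSet_singleton n)

lemma measurableSet_R (h : IsModel θ P Nplus Y R) : MeasurableSet {ω | R ω = true} :=
  h.measurable_R (measurableSet_singleton true)

lemma measurable_freq (h : IsModel θ P Nplus Y R) : Measurable (freq Nplus R) :=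
  Measurable.ite h.measurableSet_R h.measurable_Nplus measurable_const

lemma lintegral_R_mul (h : IsModel θ P Nplus Y R) {k : ℕ} {g : ℕ × (Fin k → ℝ) → ℝ≥0∞}
    (hg : Measurable g) :
    ∫⁻ ω, (if R ω = true then 1 else 0) * g (Nplus ω, fun i : Fin k => Y i ω) ∂P =
      ENNReal.ofReal θ.p * ∫⁻ ω, g (Nplus ω, fun i : Fin k => Y i ω) ∂P := by
  have hb : Measurable fun b : Bool => if b = true then (1 : ℝ≥0∞) else 0 := measurable_of_finite _
  have hpair : Measurable fun ω => (Nplus ω, fun i : Fin k => Y i ω) :=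
    h.measurable_Nplus.prodMk (measurable_pi_lambda _ fun i => h.measurable_Y i)
  have hi := (h.indep k).comp hb hg
  have := lintegral_mul_eq_lintegral_mul_lintegral_of_indepFun (hb.comp h.measurable_R)
    (hg.comp hpair) hi
  refine this.trans ?_
  congr 1
  rw [← h.prob_R, ← lintegral_indicator_one h.measurableSet_R]
  refine lintegral_congr fun ω => ?_
  by_cases hR : R ω = true <;> simp [hR]

lemma integral_eq_toReal_partialMean (h : IsModel θ P Nplus Y R) (n : ℕ) :
    ∫ y in Ioi (0 : ℝ), y * hPDF θ P Nplus n y = (partialMean θ P Nplus n).toReal := by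
  have := h.measurable_hPDF n
  refine integral_eq_lintegral_of_nonneg_ae ?_ (by fun_prop)
  filter_upwards [ae_restrict_mem measurableSet_Ioi] with y hy
  exact mul_nonneg (le_of_lt hy) (h.hPDF_nonneg n y)

lemma measure_freq_pos (h : IsModel θ P Nplus Y R) :
    P {ω | (0 : ℝ) < freq Nplus R ω} = ENNReal.ofReal θ.p := by
  rw [← h.prob_R]
  refine measure_congr ?_
  filter_upwards [h.Nplus_pos] with ω hω
  refine propext ?_
  change (0 : ℝ) < freq Nplus R ω ↔ R ω = true
  by_cases hR : R ω = true <;> simp [freq, hR, hω]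

lemma lintegral_freq (h : IsModel θ P Nplus Y R) (w : ℕ → ℝ≥0∞) (hw : w 0 = 0) :
    ∫⁻ ω, w (freq Nplus R ω) ∂P =
      ENNReal.ofReal θ.p * ∑' n : ℕ+, w n * P {ω | Nplus ω = n} := by
  have hae : (fun ω => w (freq Nplus R ω)) =ᵐ[P] fun ω =>
      (if R ω = true then 1 else 0) * ∑' n : ℕ+, if Nplus ω = n then w n else 0 := by
    filter_upwards [h.Nplus_pos] with ω hω
    by_cases hR : R ω = true
    · simp only [freq, hR, if_true, one_mul]
      obtain ⟨m, hm⟩ : ∃ m : ℕ+, (m : ℕ) = Nplus ω := ⟨⟨_, hω⟩, rfl⟩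
      rw [← hm, tsum_eq_single m, if_pos rfl]
      exact fun n hn => if_neg fun hc => hn (PNat.eq hc.symm)
    · simp [freq, hR, hw]
  have hm (n : ℕ+) : Measurable fun q : ℕ × (Fin 0 → ℝ) => if q.1 = n then w n else 0 :=
    (measurable_from_nat (f := fun m : ℕ => if m = n then w n else 0)).comp measurable_fst
  -- With `k = 0` only the independence of `R` and `N⁺` is used.
  rw [lintegral_congr_ae hae, h.lintegral_R_mul (k := 0)
    (g := fun q => ∑' n : ℕ+, if q.1 = n then w n else 0) (Measurable.tsum hm)]
  congr 1
  have hm' (n : ℕ+) : Measurable fun ω => if Nplus ω = n then w n else 0 :=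
    (measurable_from_nat (f := fun m : ℕ => if m = n then w n else 0)).comp h.measurable_Nplus
  rw [lintegral_tsum fun n => (hm' n).aemeasurable]
  refine tsum_congr fun n => ?_
  rw [← lintegral_indicator_const (h.measurableSet_eq n)]
  simp only [indicator_apply, mem_ofPred_eq]

/-- Passing from an identity in `[0, ∞]` to real numbers. -/
lemma summable_and_integral_eq {μ : Measure Ω} {g : Ω → ℝ} (hg : Integrable g μ)
    (hg0 : 0 ≤ᵐ[μ] g) {p : ℝ} (hp : 0 ≤ p) {a : ℕ+ → ℝ≥0∞}
    (hga : ∫⁻ ω, ENNReal.ofReal (g ω) ∂μ = ENNReal.ofReal p * ∑' n, a n) :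
    (0 < p → (∀ n, a n ≠ ∞) ∧ Summable fun n => (a n).toReal) ∧
      ∫ ω, g ω ∂μ = p * ∑' n, (a n).toReal := by
  have hfin : ENNReal.ofReal p * ∑' n, a n ≠ ∞ := by
    rw [← hga]
    exact hg.lintegral_lt_top.ne
  -- For `p = 0` the series may diverge, since `0 * ∞ = 0` in `[0, ∞]`.
  have hsum (hp' : 0 < p) : ∑' n, a n ≠ ∞ := fun hc => hfin (by
    rw [hc, ENNReal.mul_top (ENNReal.ofReal_pos.2 hp').ne'])
  refine ⟨fun hp' => ⟨ENNReal.ne_top_of_tsum_ne_top (hsum hp'),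
    ENNReal.summable_toReal (hsum hp')⟩, ?_⟩
  rw [integral_eq_lintegral_of_nonneg_ae hg0 hg.aestronglyMeasurable, hga, ENNReal.toReal_mul,
    ENNReal.toReal_ofReal hp]
  rcases hp.eq_or_lt with rfl | hp'
  · simp
  · rw [ENNReal.tsum_toReal_eq (ENNReal.ne_top_of_tsum_ne_top (hsum hp'))]

lemma integral_freq (h : IsModel θ P Nplus Y R)
    (hint : Integrable (fun ω => (freq Nplus R ω : ℝ)) P) :
    (0 < θ.p → Summable fun n : ℕ+ => (n : ℝ) * P.real {ω | Nplus ω = n}) ∧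
      ∫ ω, (freq Nplus R ω : ℝ) ∂P = θ.p * ∑' n : ℕ+, (n : ℝ) * P.real {ω | Nplus ω = n} := by
  have h1 := h.lintegral_freq (fun n => ENNReal.ofReal n) (by simp)
  have h2 := summable_and_integral_eq hint (ae_of_all _ fun ω => Nat.cast_nonneg _) h.p_mem.1 h1
  have hterm (n : ℕ+) : (ENNReal.ofReal (n : ℕ) * P {ω | Nplus ω = n}).toReal =
      (n : ℝ) * P.real {ω | Nplus ω = n} := by
    rw [ENNReal.toReal_mul, ENNReal.toReal_ofReal (Nat.cast_nonneg _), measureReal_def]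
  simp only [hterm] at h2
  exact ⟨fun hp => (h2.1 hp).2, h2.2⟩

variable [IsProbabilityMeasure P]

lemma freqCDF_eq (h : IsModel θ P Nplus Y R) (x : ℝ) :
    freqCDF P Nplus x = P.real {ω | (Nplus ω : ℝ) ≤ x} := by
  have hm : Measurable fun ω => (Nplus ω : ℝ) := measurable_from_nat.comp h.measurable_Nplus
  have := Measure.isProbabilityMeasure_map (μ := P) hm.aemeasurable
  rw [freqCDF, cdf_eq_real, map_measureReal_apply hm measurableSet_Iic]
  rfl

/-- If `N⁺` has no atom at `n`, its distribution function agrees at `n` and `n - 1`. -/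
lemma hPDF_eq_zero (h : IsModel θ P Nplus Y R) {n : ℕ} (hn : P {ω | Nplus ω = n} = 0) (y : ℝ) :
    hPDF θ P Nplus n y = 0 := by
  have : freqCDF P Nplus n = freqCDF P Nplus ((n : ℝ) - 1) := by
    rw [h.freqCDF_eq, h.freqCDF_eq]
    refine measureReal_congr ?_
    have hae : ∀ᵐ ω ∂P, Nplus ω ≠ n := by
      rw [ae_iff]
      simpa using hn
    filter_upwards [hae] with ω hω
    refine propext ?_
    change (Nplus ω : ℝ) ≤ n ↔ (Nplus ω : ℝ) ≤ (n : ℝ) - 1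
    rw [le_sub_iff_add_le]
    norm_cast
    omega
  rw [hPDF_eq, this, sub_self, mul_zero]

lemma setLIntegral_severity (h : IsModel θ P Nplus Y R) {n j : ℕ} (hj : j < n) :
    ∫⁻ ω in {ω | Nplus ω = n}, ENNReal.ofReal (Y j ω) ∂P = partialMean θ P Nplus n := by
  by_cases hP : P {ω | Nplus ω = n} = 0
  · rw [setLIntegral_measure_zero _ _ hP, partialMean]
    simp [h.hPDF_eq_zero hP]
  have hP' : 0 < P {ω | j + 1 ≤ Nplus ω} := by
    refine (pos_iff_ne_zero.2 hP).trans_le (measure_mono fun ω hω => ?_)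
    simp only [mem_ofPred_eq] at hω ⊢
    omega
  have hm : Measurable fun y => ENNReal.ofReal (hPDF θ P Nplus n y) :=
    (h.measurable_hPDF n).ennreal_ofReal
  rw [← lintegral_map (f := fun y => ENNReal.ofReal y) (by fun_prop) (h.measurable_Y j),
    h.map_restrict_eq hj hP', lintegral_withDensity_eq_lintegral_mul _ hm (by fun_prop),
    partialMean, ← lintegral_indicator measurableSet_Ioi]
  refine lintegral_congr fun y => ?_
  by_cases hy : y ∈ Ioi (0 : ℝ)
  · rw [indicator_of_mem hy, Pi.mul_apply, mul_comm, ENNReal.ofReal_mul (le_of_lt hy)]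
  · rw [indicator_of_notMem hy, Pi.mul_apply, ENNReal.ofReal_of_nonpos (not_lt.1 hy), mul_zero]

/-- Restricted to `j < N⁺`, because the law of `Y j` is prescribed only there. The density `h`
inherits the factor `f₂`, which vanishes almost everywhere on the negative axis. -/
lemma ae_severity_nonneg (h : IsModel θ P Nplus Y R) :
    ∀ᵐ ω ∂P, ∀ j < Nplus ω, 0 ≤ Y j ω := by
  have key (n j : ℕ) (hj : j < n) : ∀ᵐ ω ∂P, Nplus ω = n → 0 ≤ Y j ω := by
    by_cases hP : P {ω | Nplus ω = n} = 0
    · have : ∀ᵐ ω ∂P, Nplus ω ≠ n := by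
        rw [ae_iff]
        simpa using hP
      filter_upwards [this] with ω hω hω'
      exact absurd hω' hω
    have hP' : 0 < P {ω | j + 1 ≤ Nplus ω} := by
      refine (pos_iff_ne_zero.2 hP).trans_le (measure_mono fun ω hω => ?_)
      simp only [mem_ofPred_eq] at hω ⊢
      omega
    have hzero : (volume.withDensity fun y => ENNReal.ofReal (hPDF θ P Nplus n y)) (Iio 0) = 0 := by
      have h0 := h.sevLaw_neg
      rw [Params.sevLaw, withDensity_apply _ measurableSet_Iio,
        lintegral_eq_zero_iff h.measurable_f₂.ennreal_ofReal] at h0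
      rw [withDensity_apply _ measurableSet_Iio,
        lintegral_eq_zero_iff (h.measurable_hPDF n).ennreal_ofReal]
      filter_upwards [h0] with y hy
      have hf : θ.f₂ y = 0 := le_antisymm (ENNReal.ofReal_eq_zero.1 hy) (h.f₂_nonneg y)
      simp [hPDF_eq, hf]
    rw [← h.map_restrict_eq hj hP', Measure.map_apply (h.measurable_Y j) measurableSet_Iio,
      Measure.restrict_apply (h.measurable_Y j measurableSet_Iio)] at hzero
    rw [ae_iff]
    refine measure_mono_null (fun ω hω => ?_) hzero
    simp only [mem_ofPred_eq, Classical.not_imp, not_le] at hω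
    exact ⟨hω.2, hω.1⟩
  have hall : ∀ᵐ ω ∂P, ∀ n j : ℕ, j < n → Nplus ω = n → 0 ≤ Y j ω := by
    simp only [ae_all_iff]
    exact key
  filter_upwards [hall] with ω hω j hj
  exact hω _ j hj rfl

/-! ### Moments of the aggregate severity -/

/-- On `N⁺ = n` the `n` severities have the same partial mean, which yields the factor `n`. The
value `w 0` is irrelevant because the empty sum is zero. -/
lemma lintegral_mul_aggregate (h : IsModel θ P Nplus Y R) (w : ℕ → ℝ≥0∞) :
    ∫⁻ ω, w (freq Nplus R ω) * ENNReal.ofReal (aggregate Nplus R Y ω) ∂P =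
      ENNReal.ofReal θ.p * ∑' n : ℕ+, w n * ((n : ℕ) * partialMean θ P Nplus n) := by
  have hae : (fun ω => w (freq Nplus R ω) * ENNReal.ofReal (aggregate Nplus R Y ω)) =ᵐ[P]
      fun ω => ∑' n : ℕ+, (if R ω = true then 1 else 0) *
        (if Nplus ω = n then w n * ∑ j : Fin n, ENNReal.ofReal (Y j ω) else 0) := by
    filter_upwards [h.Nplus_pos, h.ae_severity_nonneg] with ω hω hY
    by_cases hR : R ω = true
    · simp only [freq, aggregate, hR, if_true, one_mul]
      obtain ⟨m, hm⟩ : ∃ m : ℕ+, (m : ℕ) = Nplus ω := ⟨⟨_, hω⟩, rfl⟩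
      rw [← hm] at hY
      rw [← hm, tsum_eq_single m, if_pos rfl,
        ENNReal.ofReal_sum_of_nonneg fun j hj => hY j (Finset.mem_range.1 hj), Finset.sum_range]
      exact fun n hn => if_neg fun hc => hn (PNat.eq hc.symm)
    · simp [freq, aggregate, hR]
  have hm (n : ℕ+) : Measurable fun q : ℕ × (Fin n → ℝ) =>
      if q.1 = n then w n * ∑ j : Fin n, ENNReal.ofReal (q.2 j) else 0 :=
    Measurable.ite (measurable_fst (measurableSet_singleton (n : ℕ))) (by fun_prop)
      measurable_const
  have hmR : Measurable fun ω => if R ω = true then (1 : ℝ≥0∞) else 0 :=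
    Measurable.ite h.measurableSet_R measurable_const measurable_const
  have hmY (n : ℕ+) : Measurable fun ω =>
      if Nplus ω = n then w n * ∑ j : Fin n, ENNReal.ofReal (Y j ω) else 0 := by
    have := h.measurable_Y
    exact Measurable.ite (h.measurableSet_eq n) (by fun_prop) measurable_const
  have hmul (n : ℕ+) : Measurable fun ω => (if R ω = true then (1 : ℝ≥0∞) else 0) *
      (if Nplus ω = n then w n * ∑ j : Fin n, ENNReal.ofReal (Y j ω) else 0) := hmR.mul (hmY n)
  rw [lintegral_congr_ae hae, lintegral_tsum fun n => (hmul n).aemeasurable,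
    ← ENNReal.tsum_mul_left]
  refine tsum_congr fun n => ?_
  -- For each `n`, independence is used with exactly `k = n` severities.
  rw [h.lintegral_R_mul (hm n)]
  congr 1
  have hY (j : ℕ) : Measurable fun ω => ENNReal.ofReal (Y j ω) := (h.measurable_Y j).ennreal_ofReal
  calc ∫⁻ ω, (if Nplus ω = n then w n * ∑ j : Fin n, ENNReal.ofReal (Y j ω) else 0) ∂P
      = ∫⁻ ω in {ω | Nplus ω = n}, w n * ∑ j : Fin n, ENNReal.ofReal (Y j ω) ∂P := by
        rw [← lintegral_indicator (h.measurableSet_eq n)]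
        simp only [indicator_apply, mem_ofPred_eq]
    _ = w n * ((n : ℕ) * partialMean θ P Nplus n) := by
        rw [lintegral_const_mul _ (by fun_prop), lintegral_finsetSum _ fun (j : Fin n) _ => hY j]
        simp only [h.setLIntegral_severity (Fin.is_lt _), Finset.sum_const, Finset.card_univ,
          Fintype.card_fin, nsmul_eq_mul]

lemma aggregate_nonneg (h : IsModel θ P Nplus Y R) : 0 ≤ᵐ[P] aggregate Nplus R Y := by
  filter_upwards [h.ae_severity_nonneg] with ω hω
  refine Finset.sum_nonneg fun j hj => ?_
  have hj := Finset.mem_range.1 hj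
  unfold freq at hj
  split_ifs at hj
  · exact hω j hj
  · omega

lemma integral_mul_aggregate (h : IsModel θ P Nplus Y R) {w : ℕ → ℝ} (hw : ∀ n, 0 ≤ w n)
    (hint : Integrable (fun ω => w (freq Nplus R ω) * aggregate Nplus R Y ω) P) :
    (0 < θ.p → Summable fun n : ℕ+ =>
        w n * (n * ∫ y in Ioi (0 : ℝ), y * hPDF θ P Nplus (n : ℕ) y)) ∧
      ∫ ω, w (freq Nplus R ω) * aggregate Nplus R Y ω ∂P =
        θ.p * ∑' n : ℕ+, w n * (n * ∫ y in Ioi (0 : ℝ), y * hPDF θ P Nplus (n : ℕ) y) := by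
  have h1 := h.lintegral_mul_aggregate fun n => ENNReal.ofReal (w n)
  simp only [← ENNReal.ofReal_mul (hw _)] at h1
  have hnn : 0 ≤ᵐ[P] fun ω => w (freq Nplus R ω) * aggregate Nplus R Y ω := by
    filter_upwards [h.aggregate_nonneg] with ω hω
    exact mul_nonneg (hw _) hω
  have h2 := summable_and_integral_eq hint hnn h.p_mem.1 h1
  have hterm (n : ℕ+) : (ENNReal.ofReal (w n) * ((n : ℕ) * partialMean θ P Nplus n)).toReal =
      w n * (n * ∫ y in Ioi (0 : ℝ), y * hPDF θ P Nplus (n : ℕ) y) := by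
    rw [h.integral_eq_toReal_partialMean, ENNReal.toReal_mul, ENNReal.toReal_mul,
      ENNReal.toReal_ofReal (hw _), ENNReal.toReal_natCast]
  simp only [hterm] at h2
  exact ⟨fun hp => (h2.1 hp).2, h2.2⟩

lemma integrableOn_mul_hPDF (h : IsModel θ P Nplus Y R) (hp : 0 < θ.p)
    (hint : Integrable (aggregate Nplus R Y) P) (n : ℕ+) :
    IntegrableOn (fun y => y * hPDF θ P Nplus (n : ℕ) y) (Ioi 0) := by
  have h1 := h.lintegral_mul_aggregate fun _ => 1
  simp only [one_mul] at h1
  have h2 := ((summable_and_integral_eq hint h.aggregate_nonneg h.p_mem.1 h1).1 hp).1 n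
  have h3 : partialMean θ P Nplus n ≠ ∞ := fun hc => h2 (by
    rw [hc, ENNReal.mul_top (by exact_mod_cast n.ne_zero)])
  have := h.measurable_hPDF n
  refine ⟨by fun_prop, ?_⟩
  rw [hasFiniteIntegral_iff_ofReal]
  · exact h3.lt_top
  · filter_upwards [ae_restrict_mem measurableSet_Ioi] with y hy
    exact mul_nonneg (le_of_lt hy) (h.hPDF_nonneg n y)

end IsModel

/-! ### Covariance and conditional expectation -/

/-- Integrability of the product replaces square integrability, so no second moments of `N` or `S`
are needed. -/
lemma covariance_eq_of_integrable {μ : Measure Ω} [IsProbabilityMeasure μ] {X Z : Ω → ℝ}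
    (hX : Integrable X μ) (hZ : Integrable Z μ) (hXZ : Integrable (fun ω => X ω * Z ω) μ) :
    cov[X, Z; μ] = ∫ ω, X ω * Z ω ∂μ - (∫ ω, X ω ∂μ) * ∫ ω, Z ω ∂μ := by
  set a := ∫ ω, X ω ∂μ
  set b := ∫ ω, Z ω ∂μ
  have e : ∀ ω, (X ω - a) * (Z ω - b) = (X ω * Z ω - X ω * b) - (a * Z ω - a * b) :=
    fun ω => by ring
  have h1 : Integrable (fun ω => X ω * b) μ := hX.mul_const b
  have h2 : Integrable (fun ω => a * Z ω) μ := hZ.const_mul a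
  have h3 : Integrable (fun ω => X ω * Z ω - X ω * b) μ := hXZ.sub h1
  have h4 : Integrable (fun ω => a * Z ω - a * b) μ := h2.sub (integrable_const _)
  have hcov : cov[X, Z; μ] = ∫ ω, (X ω - a) * (Z ω - b) ∂μ := rfl
  rw [hcov]
  simp only [e]
  rw [integral_sub h3 h4, integral_sub hXZ h1, integral_sub h2 (integrable_const _),
    integral_mul_const, integral_const_mul, integral_const, probReal_univ, one_smul]
  change _ - a * b - (a * b - a * b) = _
  ring

lemma integral_cond_of_eq_zero (μ : Measure Ω) {A : Set Ω} (g : Ω → ℝ)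
    (hg : ∀ ω ∉ A, g ω = 0) : ∫ ω, g ω ∂μ[|A] = (μ.real A)⁻¹ * ∫ ω, g ω ∂μ := by
  rw [ProbabilityTheory.cond, integral_smul_measure, setIntegral_eq_integral_of_forall_compl_eq_zero hg,
    ENNReal.toReal_inv, smul_eq_mul, measureReal_def]

lemma integrable_cond {μ : Measure Ω} {A : Set Ω} (hA : μ A ≠ 0) {g : Ω → ℝ}
    (hg : Integrable g μ) : Integrable g μ[|A] :=
  hg.restrict.smul_measure (ENNReal.inv_ne_top.2 hA)

end Moments

end CollectiveRisk

/-! ### Mean of `S` and the two covariances -/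

open CollectiveRisk in
theorem proposition5 {Ω : Type*} [MeasurableSpace Ω] (P : Measure Ω) [IsProbabilityMeasure P]
    (θ : Params) (Nplus : Ω → ℕ) (Y : ℕ → Ω → ℝ) (R : Ω → Bool)
    (hmodel : IsModel θ P Nplus Y R)
    (N S M : Ω → ℝ)
    (hN : N = fun ω => (freq Nplus R ω : ℝ))
    (hS : S = aggregate Nplus R Y)
    (hM : M = average Nplus R Y)
    (f : ℕ+ → ℝ) (hf : f = fun n : ℕ+ => P.real {ω | Nplus ω = n})
    (h : ℕ+ → ℝ → ℝ) (hh : h = fun n : ℕ+ => hPDF θ P Nplus (n : ℕ))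
    (I : ℕ+ → ℝ) (hI : I = fun n : ℕ+ => ∫ y in Ioi (0 : ℝ), y * h n y) :
    -- the mean of `S`, as an identity in `[0, ∞]`
    (0 ≤ᵐ[P] S ∧ (∀ n, ∀ y, 0 ≤ h n y) ∧
      ∫⁻ ω, ENNReal.ofReal (S ω) ∂P =
        ENNReal.ofReal θ.p *
          ∑' n : ℕ+, (n : ℝ≥0∞) * ∫⁻ y in Ioi (0 : ℝ), ENNReal.ofReal (y * h n y)) ∧
    -- the mean of `S`, as a real number
    (Integrable S P →
      (0 < θ.p → (∀ n, IntegrableOn (fun y => y * h n y) (Ioi 0)) ∧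
        Summable fun n : ℕ+ => (n : ℝ) * I n) ∧
      ∫ ω, S ω ∂P = θ.p * ∑' n : ℕ+, (n : ℝ) * I n) ∧
    -- the covariance of `N` and `S`
    (Integrable N P → Integrable S P → Integrable (fun ω => N ω * S ω) P →
      (0 < θ.p → (Summable fun n : ℕ+ => (n : ℝ) ^ 2 * I n) ∧
        Summable fun n : ℕ+ => (n : ℝ) * f n) ∧
      cov[N, S; P] =
        θ.p * ∑' n : ℕ+, (n : ℝ) ^ 2 * I n -
          (θ.p * ∑' n : ℕ+, (n : ℝ) * f n) * (θ.p * ∑' n : ℕ+, (n : ℝ) * I n)) ∧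
    -- the covariance of `N` and `M` given `N > 0`
    (0 < θ.p → Integrable N P → Integrable S P →
      Summable I ∧
      cov[N, M; P[|{ω | 0 < N ω}]] =
        ∑' n : ℕ+, (n : ℝ) * I n - (∑' n : ℕ+, (n : ℝ) * f n) * ∑' n : ℕ+, I n) := by
  subst hh hI hf
  have hmean (hSint : Integrable S P) :
      (0 < θ.p → Summable fun n : ℕ+ =>
        (n : ℝ) * ∫ y in Ioi (0 : ℝ), y * hPDF θ P Nplus (n : ℕ) y) ∧
      ∫ ω, S ω ∂P =
        θ.p * ∑' n : ℕ+, (n : ℝ) * ∫ y in Ioi (0 : ℝ), y * hPDF θ P Nplus (n : ℕ) y := by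
    subst hS
    have := hmodel.integral_mul_aggregate (w := fun _ => 1) (fun _ => zero_le_one)
      (by simpa only [one_mul] using hSint)
    simpa only [one_mul] using this
  refine ⟨⟨?_, fun n y => hmodel.hPDF_nonneg n y, ?_⟩, fun hSint => ⟨fun hp => ⟨?_, ?_⟩, ?_⟩, ?_, ?_⟩
  · rw [hS]
    exact hmodel.aggregate_nonneg
  · have := hmodel.lintegral_mul_aggregate fun _ => 1
    simp only [one_mul] at this
    rw [hS]
    exact this
  · subst hS
    exact hmodel.integrableOn_mul_hPDF hp hSint
  · exact (hmean hSint).1 hp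
  · exact (hmean hSint).2
  · intro hNint hSint hNS
    obtain ⟨-, hSm⟩ := hmean hSint
    subst hN hS
    have hNm := hmodel.integral_freq hNint
    have hNSm := hmodel.integral_mul_aggregate (w := fun n => (n : ℝ)) (fun n => n.cast_nonneg) hNS
    simp only [← mul_assoc, ← sq] at hNSm
    refine ⟨fun hp => ⟨hNSm.1 hp, hNm.1 hp⟩, ?_⟩
    rw [covariance_eq_of_integrable hNint hSint hNS, hNSm.2, hNm.2, hSm]
  · intro hp hNint hSint
    obtain ⟨-, hSm⟩ := hmean hSint
    subst hN hS
    have hNm := hmodel.integral_freq hNint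
    have hMeq : M = fun ω => (freq Nplus R ω : ℝ)⁻¹ * aggregate Nplus R Y ω := by
      ext ω
      rw [hM, CollectiveRisk.average, div_eq_inv_mul]
    -- `|M| ≤ |S|`, because the inverse of a natural number is at most one, also at `0`.
    have hMint : Integrable M P := by
      refine hSint.mono ?_ (ae_of_all _ fun ω => ?_)
      · rw [hMeq]
        have hm : Measurable fun ω => (freq Nplus R ω : ℝ)⁻¹ :=
          (measurable_from_nat (f := fun n : ℕ => (n : ℝ)⁻¹)).comp hmodel.measurable_freq
        exact hm.aestronglyMeasurable.mul hSint.aestronglyMeasurable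
      · rw [hMeq, norm_mul, norm_inv]
        refine mul_le_of_le_one_left (norm_nonneg _) ?_
        rw [Real.norm_natCast]
        exact Nat.cast_inv_le_one _
    have hMm := hmodel.integral_mul_aggregate (w := fun n => (n : ℝ)⁻¹)
      (fun n => inv_nonneg.2 n.cast_nonneg) (by rwa [← hMeq])
    have hcancel (n : ℕ+) (x : ℝ) : ((n : ℕ) : ℝ)⁻¹ * ((n : ℕ) * x) = x :=
      inv_mul_cancel_left₀ (by exact_mod_cast n.ne_zero) x
    simp only [hcancel] at hMm
    -- This holds on `N = 0` too, where `S` is an empty sum.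
    have hNM (ω : Ω) : (freq Nplus R ω : ℝ) * M ω = aggregate Nplus R Y ω := by
      rw [hM, CollectiveRisk.average]
      by_cases h0 : freq Nplus R ω = 0
      · simp [aggregate, h0]
      · exact mul_div_cancel₀ _ (by exact_mod_cast h0)
    refine ⟨hMm.1 hp, ?_⟩
    set A := {ω | (0 : ℝ) < freq Nplus R ω} with hAdef
    have hPA := hmodel.measure_freq_pos
    have hPA0 : P A ≠ 0 := by
      rw [hPA]
      exact (ENNReal.ofReal_pos.2 hp).ne'
    have hPAr : P.real A = θ.p := by
      rw [measureReal_def, hPA, ENNReal.toReal_ofReal hp.le]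
    have := cond_isProbabilityMeasure hPA0
    have hN0 (ω : Ω) (hω : ω ∉ A) : (freq Nplus R ω : ℝ) = 0 :=
      le_antisymm (not_lt.1 hω) (Nat.cast_nonneg _)
    have hM0 (ω : Ω) (hω : ω ∉ A) : M ω = 0 := by
      rw [hM, CollectiveRisk.average, hN0 ω hω, div_zero]
    -- `N`, `M` and `N M = S` vanish off `A`, so each conditional mean is the unconditional one
    -- divided by `p`, which cancels the factor `p` in each series.
    rw [covariance_eq_of_integrable (integrable_cond hPA0 hNint) (integrable_cond hPA0 hMint)
      (by simpa only [hNM] using integrable_cond hPA0 hSint),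
      integral_cond_of_eq_zero P _ fun ω hω => by rw [hN0 ω hω, zero_mul],
      integral_cond_of_eq_zero P _ hN0, integral_cond_of_eq_zero P _ hM0, hPAr]
    simp only [hNM]
    rw [hSm, hNm.2, show ∫ ω, M ω ∂P = _ from (congrArg (fun g => ∫ ω, g ω ∂P) hMeq).trans hMm.2]
    field_simp
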